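/- Let $\mu=\delta_1+\delta_i$ on the unit circle $\mathbb T$, and let $D(\mu)$ be the Dirichlet-type space of all holomorphic $f$ on the open unit disc $\mathbb D$ with $\int_{\mathbb D}|f'|^2P_\mu\,dA<\infty$, where $P_\mu(z)=\int_{\mathbb T}\frac{1-|z|^2}{|z-\zeta|^2}\,d\mu(\zeta)$ and $dA$ is normalised area measure, equipped with the norm $\|f\|^2=\|f\|_{H^2}^2+\int_{\mathbb D}|f'|^2P_\mu\,dA$. There are real constants $a,b,c,d,p,q,m$ with $d>0$, and $s\in\mathbb C$, with the following properties. 1. With $Q(z)=z^2-a(1+i)z+bi$ one has $z^4-(3+3i)z^3+8iz^2+(3-3i)z-1=Q(z)\,(z^2-c(1+i)z+di)$ for all $z$, where all roots of $Q$ satisfy $|z|>1$ and all roots of the other factor satisfy $|z|<1$. 2. The function $O(z)=\frac{(z-1)(z-i)}{\sqrt d\,Q(z)}$ satisfies $O'(1)=-p-qi$ and $O'(i)=q+pi$. The number $m$ is the derivative at $z=1$ of $\frac{z-i}{\sqrt d\,Q(z)\,O'(1)}$. 3. With $w=\frac{1}{O'(1)\,\overline{O'(i)}\,(1+i)}$,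 $$\begin{pmatrix} m& w\\ \bar w& m\end{pmatrix}^{-1}=\begin{pmatrix}a-1&s\\ \bar s&a-1\end{pmatrix}.$$ 4. Numerically, each up to an error less than $10^{-13}$: $a\approx 2.53579711118167$, $b\approx 5.46269136247034$, $p\approx 0.954692530486206$, $q\approx 0.297593972106043$, $\operatorname{Re}s\approx 0.967575626606929$, $\operatorname{Im}s\approx 0.177124344467703$. 5. $D(\mu)$ is a reproducing kernel Hilbert space on $\mathbb D$, and its reproducing kernel is, for $z,\lambda\in\mathbb D$, $$K(z,\lambda)=\frac{b}{\overline{Q(\lambda)}\,Q(z)}\Bigg[\frac{(\bar\lambda-1)(\bar\lambda+i)(z-1)(z-i)}{1-\bar\lambda z}+(a-1)\big((\bar\lambda+i)(z-i)+(\bar\lambda-1)(z-1)\big)+\frac{\bar s(\bar\lambda-1)(z-i)}{-i(q-pi)^2}+\frac{s(\bar\lambda+i)(z-1)}{i(q+pi)^2}\Bigg].$$ -/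

import Mathlib

open Complex MeasureTheory
open scoped ENNReal ComplexConjugate Complex.UnitDisc

noncomputable section

/-- Extension by zero of a function on the open unit disc. It is only used to speak about
derivatives at points of the (open) disc. -/
def discExtend (f : 𝔻 → ℂ) (z : ℂ) : ℂ :=
  if h : ‖z‖ < 1 then f (UnitDisc.mk z h) else 0

/-- `f` is holomorphic on the open unit disc. -/
def IsHolomorphicOnDisc (f : 𝔻 → ℂ) : Prop :=
  DifferentiableOn ℂ (discExtend f) (Metric.ball (0 : ℂ) 1)

/-- The `n`-th Taylor coefficient at the origin of `f`. -/
def discCoeff (f : 𝔻 → ℂ) (n : ℕ) : ℂ :=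
  iteratedDeriv n (discExtend f) 0 / (n.factorial : ℂ)

/-- The square of the norm of the Hardy space `H²`, as an element of `[0, ∞]`. -/
def hardyNormSq (f : 𝔻 → ℂ) : ℝ≥0∞ :=
  ∑' n : ℕ, ‖discCoeff f n‖ₑ ^ 2

/-- The Poisson integral at `z` in the disc of a positive measure on the unit circle. -/
def poissonIntegral (μ : Measure (Metric.sphere (0 : ℂ) 1)) (z : ℂ) : ℝ≥0∞ :=
  ∫⁻ ζ, ENNReal.ofReal ((1 - ‖z‖ ^ 2) / ‖z - (ζ : ℂ)‖ ^ 2) ∂μ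

/-- The weighted Dirichlet integral `∫_𝔻 |f'|² P_μ dA`, where `dA` is the area measure on the
disc normalised to have total mass one. -/
def dirichletIntegral (μ : Measure (Metric.sphere (0 : ℂ) 1)) (f : 𝔻 → ℂ) : ℝ≥0∞ :=
  (ENNReal.ofReal Real.pi)⁻¹ *
    ∫⁻ z in Metric.ball (0 : ℂ) 1, ‖deriv (discExtend f) z‖ₑ ^ 2 * poissonIntegral μ z

/-- The Dirichlet-type space `D(μ)`, as a set of functions on the disc. -/
def dirichletTypeSpace (μ : Measure (Metric.sphere (0 : ℂ) 1)) : Set (𝔻 → ℂ) :=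
  {f | IsHolomorphicOnDisc f ∧ dirichletIntegral μ f < ∞}

/-- The reproducing kernel Hilbert space `H` of functions on the disc is the Dirichlet-type space
`D(μ)`: its elements are exactly the functions in `D(μ)`, and its norm is given by
`‖f‖² = ‖f‖²_{H²} + ∫_𝔻 |f'|² P_μ dA` (which determines its inner product by polarization). -/
structure IsDirichletTypeSpace (μ : Measure (Metric.sphere (0 : ℂ) 1))
    (H : Type*) [NormedAddCommGroup H] [InnerProductSpace ℂ H] [RKHS ℂ H 𝔻 ℂ] : Prop where
  range_eq : Set.range (fun h : H => (h : 𝔻 → ℂ)) = dirichletTypeSpace μ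
  enorm_sq : ∀ h : H, ‖h‖ₑ ^ 2 = hardyNormSq (h : 𝔻 → ℂ) + dirichletIntegral μ (h : 𝔻 → ℂ)

/-- The point `1` of the unit circle. -/
def circleOne : Metric.sphere (0 : ℂ) 1 := ⟨1, by simp⟩

/-- The point `i` of the unit circle. -/
def circleI : Metric.sphere (0 : ℂ) 1 := ⟨I, by simp⟩

/-- The measure `δ₁ + δ_i` on the unit circle. -/
def diracOneAddDiracI : Measure (Metric.sphere (0 : ℂ) 1) :=
  Measure.dirac circleOne + Measure.dirac circleI

/-- The monic quadratic polynomial `z² - x(1+i)z + yi`. -/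
def quadPoly (x y : ℝ) (z : ℂ) : ℂ := z ^ 2 - x * (1 + I) * z + y * I

/-- The function `(z-1)(z-i) / (√d q(z))`, where `q(z) = z² - a(1+i)z + bi`. -/
def outerFn (a b d : ℝ) (z : ℂ) : ℂ :=
  (z - 1) * (z - I) / ((Real.sqrt d : ℂ) * quadPoly a b z)

/-- The exact description of the constants appearing in the kernel. -/
structure IsKernelConstants (a b c d p q m : ℝ) (s : ℂ) : Prop where
  /-- The quartic polynomial is the product of two quadratic factors. -/
  factorization : ∀ z : ℂ,
    z ^ 4 - (3 + 3 * I) * z ^ 3 + 8 * I * z ^ 2 + (3 - 3 * I) * z - 1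
      = quadPoly a b z * quadPoly c d z
  /-- The first factor carries the roots outside the closed disc, -/
  root_outside : ∀ z : ℂ, quadPoly a b z = 0 → 1 < ‖z‖
  /-- and the second factor those inside the open disc. -/
  root_inside : ∀ z : ℂ, quadPoly c d z = 0 → ‖z‖ < 1
  d_pos : 0 < d
  /-- `p` and `q` are given by the derivatives of the outer function at `1` and `i`. -/
  deriv_one : HasDerivAt (outerFn a b d) (-(p : ℂ) - q * I) 1
  deriv_I : HasDerivAt (outerFn a b d) ((q : ℂ) + p * I) I
  /-- `m` is the derivative at `1` of `z ↦ O(z) / (O'(1) (z - 1))`. -/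
  deriv_quot : HasDerivAt
    (fun z : ℂ => (z - I) / ((Real.sqrt d : ℂ) * quadPoly a b z * (-(p : ℂ) - q * I))) (m : ℂ) 1
  /-- `s` is the off-diagonal entry of the inverse of `[[m, w], [w̄, m]]`, where
  `w = 1 / (O'(1) * conj O'(i) * (1 + i))`; the diagonal entries of the inverse are `a - 1`. -/
  inverse : ∀ w : ℂ,
    w = 1 / ((-(p : ℂ) - q * I) * conj ((q : ℂ) + p * I) * (1 + I)) →
      !![(m : ℂ), w; conj w, (m : ℂ)] * !![(a : ℂ) - 1, s; conj s, (a : ℂ) - 1] = 1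

end

noncomputable section

open Filter Topology

/-! The starting point is the local Dirichlet formula: for a point mass at `ζ`, the energy of `f =
f(ζ) + (z - ζ) g` is `‖g‖²` in `H²`, and finite energy forces `f` to have this form with `g` in `H²`
(`dirichletIntegral_dirac_eq_tsum`, `exists_of_dirichletIntegral_dirac_lt_top`). Both directions
come from one identity for arithmetic means, `cesaroMean.sum_norm_sq`. Hence the space for finitely
many point masses is a closed subspace of `ℓ²`, consisting of the coefficients of `f` and of its
quotients `g_i` (`dirichletModel`). Any other realisation has the same kernel, because functions and
norms determine it (`RKHS.kernel_eq_of_range_eq`).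

In the model, summation by parts turns `⟨k, f⟩ = f(λ)` into a functional equation for `k`
(`dirichletModel.kernel_eq`): `k(z) + ∑ z / (1 - ζ̄_i z) · (k(z) - k(ζ_i)) / (z - ζ_i) = 1 / (1 - λ̄
z)`. For the points `1` and `i`, clearing denominators multiplies `k` by the quartic. The quartic is
the spectral factorization of the weight: on the circle it equals `i z²` times `|z-1|²|z-i|² +
|z-1|² + |z-i|²`, which is `d |Q|²`, so `|O|⁻² = 1 + |z-1|⁻² + |z-i|⁻²` there. This explains the
leading term `O(z) conj(O(λ)) / (1 - λ̄ z)` of the kernel; the rest is a two-dimensional correction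
for the values at `1` and `i`. The factor `Q` cancels against the denominator of `k`, and what
remains is `kernel_polynomial_identity`.

Matching coefficients in the factorization gives two equations for `a` and `b`. They are solved by
radicals, and every property of the constants follows from them. -/

lemma hasSum_of_eq {ι : Type*} {f g : ι → ℂ} {x : ℂ} (h : HasSum f x) (e : ∀ i, f i = g i) :
    HasSum g x :=
  funext e ▸ h

/-! ### Power series on the unit disc. -/

/-- `F` is the sum of the power series `∑ aₙ zⁿ` on the open unit disc. -/
def DiscSeries (a : ℕ → ℂ) (F : ℂ → ℂ) : Prop :=
  ∀ z : ℂ, ‖z‖ < 1 → HasSum (fun n => a n * z ^ n) (F z)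

namespace DiscSeries

variable {a b : ℕ → ℂ} {F G : ℂ → ℂ}

lemma congr (h : DiscSeries a F) (hFG : ∀ z, ‖z‖ < 1 → F z = G z) : DiscSeries a G :=
  fun z hz => hFG z hz ▸ h z hz

lemma add (h : DiscSeries a F) (h' : DiscSeries b G) :
    DiscSeries (fun n => a n + b n) (fun z => F z + G z) := fun z hz => by
  simpa only [add_mul] using (h z hz).add (h' z hz)

lemma const_mul (h : DiscSeries a F) (c : ℂ) :
    DiscSeries (fun n => c * a n) (fun z => c * F z) := fun z hz => by
  simpa only [mul_assoc] using (h z hz).mul_left c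

lemma finset_sum {ι : Type*} (s : Finset ι) {a : ι → ℕ → ℂ} {F : ι → ℂ → ℂ}
    (h : ∀ i ∈ s, DiscSeries (a i) (F i)) :
    DiscSeries (fun n => ∑ i ∈ s, a i n) (fun z => ∑ i ∈ s, F i z) := fun z hz => by
  simpa only [Finset.sum_mul] using hasSum_sum fun i hi => h i hi z hz

lemma hasFPowerSeriesOnBall (h : DiscSeries a F) :
    HasFPowerSeriesOnBall F (FormalMultilinearSeries.ofScalars ℂ a) 0 1 where
  r_le := by
    refine ENNReal.le_of_forall_nnreal_lt fun r hr => ?_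
    refine FormalMultilinearSeries.le_radius_of_summable_norm _ ?_
    have hr' : ‖(r : ℂ)‖ < 1 := by
      have : r < 1 := by exact_mod_cast hr
      simpa using this
    refine ((h _ hr').summable.norm).congr fun n => ?_
    simp
  r_pos := one_pos
  hasSum := fun {y} hy => by
    have hy' : ‖y‖ < 1 := by
      rw [Metric.mem_eball, edist_zero_right] at hy
      rw [← ofReal_norm, ← ENNReal.ofReal_one, ENNReal.ofReal_lt_ofReal_iff one_pos] at hy
      exact hy
    simpa [FormalMultilinearSeries.ofScalars_apply_eq, mul_comm] using h y hy'

lemma differentiableOn (h : DiscSeries a F) : DifferentiableOn ℂ F (Metric.ball 0 1) := by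
  have := h.hasFPowerSeriesOnBall.differentiableOn
  rwa [← ENNReal.ofReal_one, Metric.eball_ofReal] at this

lemma unique (h : DiscSeries a F) (h' : DiscSeries b F) : a = b := by
  have := h.hasFPowerSeriesOnBall.hasFPowerSeriesAt.eq_formalMultilinearSeries
    h'.hasFPowerSeriesOnBall.hasFPowerSeriesAt
  funext n
  simpa using congrArg (fun p => FormalMultilinearSeries.coeff p n) this

lemma of_differentiableOn (h : DifferentiableOn ℂ F (Metric.ball 0 1)) :
    DiscSeries (fun n => iteratedDeriv n F 0 / (n.factorial : ℂ)) F := fun z hz => by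
  have := Complex.hasSum_taylorSeries_on_ball h (z := z) (by simpa using hz)
  refine hasSum_of_eq this fun n => ?_
  simp only [smul_eq_mul, sub_zero, div_eq_mul_inv]
  ring

lemma coeff_eq (h : DiscSeries a F) (n : ℕ) : a n = iteratedDeriv n F 0 / (n.factorial : ℂ) :=
  congrFun (h.unique (of_differentiableOn h.differentiableOn)) n

lemma deriv (h : DiscSeries a F) : DiscSeries (fun n => (n + 1) * a (n + 1)) (deriv F) := by
  have hd := h.differentiableOn.deriv Metric.isOpen_ball
  have := of_differentiableOn hd
  convert this using 2 with n
  rw [h.coeff_eq, ← iteratedDeriv_succ', Nat.factorial_succ]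
  push_cast
  have : (n.factorial : ℂ) ≠ 0 := by exact_mod_cast n.factorial_ne_zero
  have : (n + 1 : ℂ) ≠ 0 := by exact_mod_cast n.succ_ne_zero
  field_simp

lemma shift (h : DiscSeries a F) :
    DiscSeries (fun n => Nat.casesOn n 0 a) (fun z => z * F z) := fun z hz => by
  rw [← hasSum_nat_add_iff' 1]
  rw [Finset.sum_range_one]
  change HasSum _ (z * F z - 0 * z ^ 0)
  rw [zero_mul, sub_zero]
  refine hasSum_of_eq ((h z hz).mul_left z) fun n => ?_
  ring

lemma geometric {c : ℂ} (hc : ‖c‖ ≤ 1) : DiscSeries (fun n => c ^ n) (fun z => (1 - c * z)⁻¹) :=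
  fun z hz => by
    simp only [← mul_pow]
    refine hasSum_geometric_of_norm_lt_one ?_
    rw [norm_mul]
    nlinarith [norm_nonneg c, norm_nonneg z]

lemma mul (h : DiscSeries a F) (h' : DiscSeries b G) :
    DiscSeries (fun n => ∑ j ∈ Finset.range (n + 1), a j * b (n - j)) (fun z => F z * G z) :=
  fun z hz => by
    have := hasSum_sum_range_mul_of_summable_norm (h z hz).summable.norm (h' z hz).summable.norm
    rw [(h z hz).tsum_eq, (h' z hz).tsum_eq] at this
    refine hasSum_of_eq this fun n => ?_
    rw [Finset.sum_mul]
    refine Finset.sum_congr rfl fun j hj => ?_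
    have : n = j + (n - j) := by have := Finset.mem_range.1 hj; omega
    conv_rhs => rw [this, pow_add]
    simp only [Nat.add_sub_cancel_left]; ring

/-- Taylor coefficients of `F = α + (z - ζ) G` in terms of those of `G`. -/
lemma coeff_succ_of_eq {α ζ : ℂ} (h : DiscSeries a F) (h' : DiscSeries b G)
    (hFG : ∀ z, ‖z‖ < 1 → F z = α + (z - ζ) * G z) (n : ℕ) :
    a (n + 1) = b n - ζ * b (n + 1) := by
  have h1 : DiscSeries (fun n => Nat.casesOn n α fun _ => 0) (fun _ => α) := fun z hz => by
    rw [← hasSum_nat_add_iff' 1]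
    simp
  have h2 := (h1.add h'.shift).add (h'.const_mul (-ζ))
  have := congrFun (h.unique (h2.congr fun z hz => by rw [hFG z hz]; ring)) (n + 1)
  simp only [this]; ring

end DiscSeries

/-! ### Parseval's identity and a weighted Bergman norm. -/

/-- Absolute summability makes the Fourier series converge uniformly. A single limit `G` then serves
both for pointwise evaluation and, after mapping to `L²`, for orthonormality of the characters. -/
lemma hasSum_normSq_toLp_fourier {T : ℝ} [Fact (0 < T)] {c : ℕ → ℂ}
    (hc : Summable fun n => ‖c n‖) :
    ∃ G : C(AddCircle T, ℂ), (∀ x, HasSum (fun n : ℕ => c n * fourier (n : ℤ) x) (G x)) ∧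
      HasSum (fun n => ‖c n‖ ^ 2) (∫ x, ‖G x‖ ^ 2 ∂(AddCircle.haarAddCircle (T := T))) := by
  have hs : Summable fun n : ℕ => c n • (fourier (n : ℤ) : C(AddCircle T, ℂ)) := by
    refine Summable.of_norm (hc.congr fun n => ?_)
    rw [norm_smul, fourier_norm, mul_one]
  obtain ⟨G, hG⟩ := hs
  refine ⟨G, fun x => ?_, ?_⟩
  · simpa using hG.mapL (ContinuousMap.evalCLM ℂ x)
  have h1 := hG.mapL (ContinuousMap.toLp (E := ℂ) 2 (AddCircle.haarAddCircle (T := T)) ℂ)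
  set g := ContinuousMap.toLp (E := ℂ) 2 (AddCircle.haarAddCircle (T := T)) ℂ G
  have ho := orthonormal_fourier (T := T)
  have h2 : HasSum (fun n => c n • fourierLp (T := T) 2 (n : ℤ)) g := by
    simpa [fourierLp] using h1
  have h3 (m : ℕ) : inner ℂ g (fourierLp (T := T) 2 (m : ℤ)) = conj (c m) := by
    have h4 := h2.mapL (innerSL ℂ (fourierLp (T := T) 2 (m : ℤ)))
    have h5 := h4.unique (hasSum_single m fun n hn => by
      have := ho.2 (i := (m : ℤ)) (j := n) (by exact_mod_cast hn.symm)
      simp only [innerSL_apply_apply, inner_smul_right, this, mul_zero])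
    rw [← inner_conj_symm]
    simp only [innerSL_apply_apply, inner_smul_right] at h5
    rw [h5, inner_self_eq_norm_sq_to_K, ho.1]
    simp
  have h6 := h2.mapL (innerSL ℂ g)
  simp only [innerSL_apply_apply, inner_smul_right, h3, Complex.mul_conj] at h6
  have h7 : inner ℂ g g = ((∫ x, ‖G x‖ ^ 2 ∂(AddCircle.haarAddCircle (T := T)) : ℝ) : ℂ) := by
    rw [L2.inner_def, ← integral_complex_ofReal]
    refine integral_congr_ae ?_
    filter_upwards [ContinuousMap.coeFn_toLp (p := 2) (𝕜 := ℂ)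
      (AddCircle.haarAddCircle (T := T)) G] with x hx
    rw [show g x = G x from hx, RCLike.inner_apply, Complex.mul_conj, Complex.normSq_eq_norm_sq]
  rw [h7] at h6
  simp only [Complex.normSq_eq_norm_sq] at h6
  exact_mod_cast h6

open Real in
/-- Parseval's identity on the circle for absolutely convergent power series. -/
lemma lintegral_enorm_sq_circle {c : ℕ → ℂ} (hc : Summable fun n => ‖c n‖) {f : ℝ → ℂ}
    (hf : ∀ θ : ℝ, HasSum (fun n => c n * Complex.exp (θ * I) ^ n) (f θ)) :
    ∫⁻ θ in Set.Ioo (-π) π, ‖f θ‖ₑ ^ 2 = ENNReal.ofReal (2 * π) * ∑' n, ‖c n‖ₑ ^ 2 := by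
  have : Fact (0 < 2 * π) := ⟨two_pi_pos⟩
  obtain ⟨G, hG, hG2⟩ := hasSum_normSq_toLp_fourier (T := 2 * π) hc
  have hfG (θ : ℝ) : f θ = G (θ : AddCircle (2 * π)) := by
    refine (hf θ).unique (hasSum_of_eq (hG θ) fun n => ?_)
    rw [fourier_coe_apply, ← Complex.exp_nat_mul]
    congr 2
    have : (π : ℂ) ≠ 0 := by exact_mod_cast pi_ne_zero
    push_cast
    field_simp
  have hcont : Continuous f := by
    rw [show f = fun θ : ℝ => G (θ : AddCircle (2 * π)) from funext hfG]
    exact G.continuous.comp (AddCircle.continuous_mk' _)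
  have h1 : ∀ z : ℂ, ‖z‖ₑ ^ 2 = ENNReal.ofReal (‖z‖ ^ 2) := fun z => by
    rw [ENNReal.ofReal_pow (norm_nonneg _), ofReal_norm]
  have h2 : ∫ θ in Set.Ioo (-π) π, ‖f θ‖ ^ 2
      = 2 * π * ∫ x, ‖G x‖ ^ 2 ∂(AddCircle.haarAddCircle (T := 2 * π)) := by
    rw [AddCircle.integral_haarAddCircle,
      ← AddCircle.intervalIntegral_preimage (2 * π) (-π) (fun x => ‖G x‖ ^ 2),
      show -π + 2 * π = π by ring, ← integral_Ioc_eq_integral_Ioo,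
      ← intervalIntegral.integral_of_le (by linarith [pi_pos]), smul_eq_mul, ← mul_assoc,
      mul_inv_cancel₀ two_pi_pos.ne', one_mul]
    simp only [hfG]
  simp only [h1]
  rw [← ofReal_integral_eq_lintegral_ofReal, h2, ENNReal.ofReal_mul two_pi_pos.le, ← hG2.tsum_eq,
    ENNReal.ofReal_tsum_of_nonneg (fun n => by positivity) hG2.summable]
  · exact ((hcont.norm.pow 2).integrableOn_Icc (a := -π) (b := π)).mono_set Set.Ioo_subset_Icc_self
  · exact Filter.Eventually.of_forall fun θ => by positivity

open Real in
lemma lintegral_radial_weight (n : ℕ) :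
    ∫⁻ r in Set.Ioo (0 : ℝ) 1, ENNReal.ofReal (r * (1 - r ^ 2) * (r ^ n) ^ 2)
      = ENNReal.ofReal (1 / (2 * (n + 1) * (n + 2))) := by
  have hcont : Continuous fun r : ℝ => r * (1 - r ^ 2) * (r ^ n) ^ 2 := by fun_prop
  rw [← ofReal_integral_eq_lintegral_ofReal
    ((hcont.integrableOn_Icc (a := 0) (b := 1)).mono_set Set.Ioo_subset_Icc_self)]
  · congr 1
    rw [← integral_Ioc_eq_integral_Ioo, ← intervalIntegral.integral_of_le zero_le_one]
    have : (fun r : ℝ => r * (1 - r ^ 2) * (r ^ n) ^ 2)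
        = fun r => r ^ (2 * n + 1) - r ^ (2 * n + 3) := by
      funext r; ring
    rw [this, intervalIntegral.integral_sub (by simp) (by simp), integral_pow, integral_pow]
    have : (n : ℝ) + 1 ≠ 0 := by positivity
    have : (n : ℝ) + 2 ≠ 0 := by positivity
    push_cast
    simp
    field_simp
    ring
  · refine (ae_restrict_iff' measurableSet_Ioo).2 (Filter.Eventually.of_forall fun r hr => ?_)
    have : 0 ≤ 1 - r ^ 2 := by nlinarith [hr.1, hr.2]
    have := hr.1.le
    simp only [Pi.zero_apply]
    positivity

open Real in
/-- The norm of a weighted Bergman space in terms of Taylor coefficients. -/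
lemma DiscSeries.lintegral_bergman {a : ℕ → ℂ} {F : ℂ → ℂ} (h : DiscSeries a F) :
    ∫⁻ z in Metric.ball (0 : ℂ) 1, ‖F z‖ₑ ^ 2 * ENNReal.ofReal (1 - ‖z‖ ^ 2)
      = ENNReal.ofReal π * ∑' n : ℕ, ‖a n‖ₑ ^ 2 * ENNReal.ofReal (1 / ((n + 1) * (n + 2))) := by
  -- Nothing is known about `F` off the disc, so the integrand is cut off before measurability and
  -- polar coordinates are used.
  set g : ℂ → ℝ≥0∞ := (Metric.ball (0 : ℂ) 1).indicator
    fun z => ‖F z‖ₑ ^ 2 * ENNReal.ofReal (1 - ‖z‖ ^ 2) with hg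
  have hgm : Measurable g := by
    classical
    have h1 : Measurable ((Metric.ball (0 : ℂ) 1).indicator F) := by
      rw [← Set.piecewise_eq_indicator]
      exact h.differentiableOn.continuousOn.measurable_piecewise continuousOn_const
        Metric.isOpen_ball.measurableSet
    have h2 : g = fun z =>
        ‖(Metric.ball (0 : ℂ) 1).indicator F z‖ₑ ^ 2 * ENNReal.ofReal (1 - ‖z‖ ^ 2) := by
      funext z
      by_cases hz : z ∈ Metric.ball (0 : ℂ) 1
      · simp only [hg, Set.indicator_of_mem hz]
      · simp [hg, Set.indicator_of_notMem hz]
    rw [h2]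
    fun_prop
  rw [← lintegral_indicator Metric.isOpen_ball.measurableSet, ← hg,
    ← Complex.lintegral_comp_polarCoord_symm]
  have ht : polarCoord.target = Set.Ioi (0 : ℝ) ×ˢ Set.Ioo (-π) π := rfl
  rw [ht, Measure.volume_eq_prod, ← Measure.prod_restrict, lintegral_prod]
  swap
  · refine Measurable.aemeasurable ?_
    refine (ENNReal.measurable_ofReal.comp measurable_fst).mul (hgm.comp ?_)
    rw [show (Complex.polarCoord.symm : ℝ × ℝ → ℂ)
      = fun p => (p.1 : ℂ) * (Real.cos p.2 + Real.sin p.2 * Complex.I) from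
        funext Complex.polarCoord_symm_apply]
    fun_prop
  -- On each circle of radius `r < 1` the coefficients `a n * r ^ n` are absolutely summable, so
  -- Parseval applies. All terms are nonnegative, which permits integrating the resulting series in
  -- `r` term by term.
  have hin (r : ℝ) (hr : r ∈ Set.Ioi (0 : ℝ)) :
      ∫⁻ θ in Set.Ioo (-π) π, ENNReal.ofReal r • g (Complex.polarCoord.symm (r, θ))
        = (Set.Ioo (0 : ℝ) 1).indicator (fun r => ∑' n : ℕ, ENNReal.ofReal (2 * π) * ‖a n‖ₑ ^ 2 *
          ENNReal.ofReal (r * (1 - r ^ 2) * (r ^ n) ^ 2)) r := by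
    have hr0 : (0 : ℝ) < r := hr
    have hnorm (θ : ℝ) : ‖Complex.polarCoord.symm (r, θ)‖ = r := by
      rw [Complex.norm_polarCoord_symm]; exact abs_of_pos hr0
    by_cases hr1 : r < 1
    · rw [Set.indicator_of_mem (Set.mem_Ioo.2 ⟨hr0, hr1⟩)]
      have hgr (θ : ℝ) : g (Complex.polarCoord.symm (r, θ))
          = ‖F (Complex.polarCoord.symm (r, θ))‖ₑ ^ 2 * ENNReal.ofReal (1 - r ^ 2) := by
        rw [hg, Set.indicator_of_mem (by rw [mem_ball_zero_iff, hnorm]; exact hr1), hnorm]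
      have hr2 : 0 ≤ 1 - r ^ 2 := by nlinarith
      simp only [hgr, smul_eq_mul]
      rw [lintegral_const_mul' _ _ ENNReal.ofReal_ne_top,
        lintegral_mul_const' _ _ ENNReal.ofReal_ne_top,
        lintegral_enorm_sq_circle (c := fun n => a n * (r : ℂ) ^ n)]
      · rw [mul_comm (ENNReal.ofReal (2 * π)), mul_assoc, mul_comm, mul_assoc,
          ← ENNReal.tsum_mul_right]
        congr 1
        funext n
        rw [enorm_mul, mul_pow, enorm_pow,
          ENNReal.ofReal_mul (show 0 ≤ r * (1 - r ^ 2) by positivity),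
          ENNReal.ofReal_mul hr0.le, ENNReal.ofReal_pow (by positivity),
          ENNReal.ofReal_pow hr0.le, ← ofReal_norm (r : ℂ), Complex.norm_of_nonneg hr0.le]
        ring
      · have := (h (r : ℂ) (by rwa [Complex.norm_of_nonneg hr0.le])).summable.norm
        exact this
      · intro θ
        have := h (Complex.polarCoord.symm (r, θ)) (by rwa [hnorm])
        refine hasSum_of_eq this fun n => ?_
        rw [mul_assoc, ← mul_pow, Complex.polarCoord_symm_apply, Complex.exp_mul_I,
          Complex.ofReal_cos, Complex.ofReal_sin]
    · rw [Set.indicator_of_notMem (fun h => hr1 h.2)]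
      have hgr (θ : ℝ) : g (Complex.polarCoord.symm (r, θ)) = 0 := by
        rw [hg, Set.indicator_of_notMem]
        rw [mem_ball_zero_iff, hnorm]; exact hr1
      simp only [hgr, smul_zero, lintegral_zero]
  rw [setLIntegral_congr_fun measurableSet_Ioi hin,
    setLIntegral_indicator measurableSet_Ioo,
    Set.inter_eq_left.2 (Set.Ioo_subset_Ioi_self : Set.Ioo (0 : ℝ) 1 ⊆ Set.Ioi 0),
    lintegral_tsum (fun n => by fun_prop), ← ENNReal.tsum_mul_left]
  refine tsum_congr fun n => ?_
  rw [lintegral_const_mul _ (by fun_prop), lintegral_radial_weight, mul_right_comm,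
    ← ENNReal.ofReal_mul two_pi_pos.le]
  have : 2 * π * (1 / (2 * (n + 1) * (n + 2))) = π * (1 / ((n + 1) * (n + 2) : ℝ)) := by
    have : (n : ℝ) + 1 ≠ 0 := by positivity
    have : (n : ℝ) + 2 ≠ 0 := by positivity
    field_simp
  rw [this, ENNReal.ofReal_mul pi_pos.le]
  ring

/-! ### Square summability through increments of arithmetic means. -/

/-- The arithmetic mean of `γ 0, …, γ n`. -/
def cesaroMean (γ : ℕ → ℂ) (n : ℕ) : ℂ := (∑ j ∈ Finset.range (n + 1), γ j) / (n + 1)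

namespace cesaroMean

variable (γ : ℕ → ℂ)

lemma mul_eq_sum (n : ℕ) : (n + 1) * cesaroMean γ n = ∑ j ∈ Finset.range (n + 1), γ j := by
  have : (n + 1 : ℂ) ≠ 0 := by exact_mod_cast n.succ_ne_zero
  rw [cesaroMean]; field_simp

lemma eq_sub_succ (n : ℕ) :
    γ (n + 1) = (n + 2) * cesaroMean γ (n + 1) - (n + 1) * cesaroMean γ n := by
  have h := mul_eq_sum γ (n + 1)
  rw [Finset.sum_range_succ, ← mul_eq_sum γ n] at h
  push_cast at h
  linear_combination -h

/-- Abel summation. The left side is, up to a unimodular factor, a Taylor coefficient of `f' / (1 -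
ζ̄ z)`, and the factor `(n+1)(n+2)` matches the Bergman weight `1 / ((n+1)(n+2))`. -/
lemma sum_mul_sub (n : ℕ) :
    ∑ j ∈ Finset.range (n + 1), ((j : ℂ) + 1) * (γ j - γ (j + 1))
      = (n + 1) * (n + 2) * (cesaroMean γ n - cesaroMean γ (n + 1)) := by
  have h (n : ℕ) : ∑ j ∈ Finset.range (n + 1), ((j : ℂ) + 1) * (γ j - γ (j + 1))
      = ∑ j ∈ Finset.range (n + 1), γ j - (n + 1) * γ (n + 1) := by
    induction n with
    | zero => simp
    | succ k ih => rw [Finset.sum_range_succ, ih, Finset.sum_range_succ _ (k + 1)]; push_cast; ring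
  rw [h, ← mul_eq_sum, eq_sub_succ γ]
  ring

/-- With `σ`, `σ'` consecutive means, the induction step is `|(n+2)σ' - (n+1)σ|² = (n+1)(n+2)|σ -
σ'|² + (n+2)|σ'|² - (n+1)|σ|²`, so the boundary terms telescope. -/
lemma sum_norm_sq (n : ℕ) :
    ∑ j ∈ Finset.range (n + 1), ‖γ j‖ ^ 2
      = ∑ j ∈ Finset.range n,
          ((j : ℝ) + 1) * (j + 2) * ‖cesaroMean γ j - cesaroMean γ (j + 1)‖ ^ 2
        + (n + 1) * ‖cesaroMean γ n‖ ^ 2 := by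
  induction n with
  | zero => simp [cesaroMean]
  | succ n ih =>
    rw [Finset.sum_range_succ, ih, Finset.sum_range_succ _ n, eq_sub_succ γ n]
    simp only [← Complex.normSq_eq_norm_sq, Complex.normSq_apply, Complex.sub_re, Complex.sub_im,
      Complex.mul_re, Complex.mul_im, Complex.add_re, Complex.add_im, Complex.natCast_re,
      Complex.natCast_im, Complex.one_re, Complex.one_im, Complex.re_ofNat, Complex.im_ofNat]
    push_cast
    ring

variable {γ}

/-- This removes the boundary term in `sum_norm_sq`. A fixed initial block contributes `O(1/n)`, and
Cauchy–Schwarz bounds the rest by a tail of `∑ ‖γ n‖²`. -/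
lemma tendsto_mul_norm_sq (h : Summable fun n => ‖γ n‖ ^ 2) :
    Tendsto (fun n : ℕ => ((n : ℝ) + 1) * ‖cesaroMean γ n‖ ^ 2) atTop (𝓝 0) := by
  have hlim : Tendsto (fun n : ℕ => (∑' j, ‖γ j‖ ^ 2) - ∑ j ∈ Finset.range n, ‖γ j‖ ^ 2)
      atTop (𝓝 0) := by
    have := h.hasSum.tendsto_sum_nat.const_sub (∑' j, ‖γ j‖ ^ 2)
    rwa [sub_self] at this
  rw [Metric.tendsto_atTop] at hlim ⊢
  intro ε hε
  obtain ⟨M, hM⟩ := hlim (ε / 4) (by positivity)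
  have hM := hM M le_rfl
  rw [Real.dist_eq, sub_zero] at hM
  set C := ‖∑ j ∈ Finset.range M, γ j‖
  obtain ⟨N, hN⟩ := exists_nat_gt (4 * C ^ 2 / ε)
  refine ⟨max M N, fun n hn => ?_⟩
  have hMn : M ≤ n + 1 := by have := le_max_left M N; omega
  have hNn : (N : ℝ) ≤ n := by exact_mod_cast (le_max_right M N).trans hn
  have hn1 : (0 : ℝ) < n + 1 := by positivity
  have htail : ‖∑ j ∈ Finset.Ico M (n + 1), γ j‖ ^ 2 ≤ (n + 1) * (ε / 4) := by
    have h1 : ‖∑ j ∈ Finset.Ico M (n + 1), γ j‖ ^ 2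
        ≤ (∑ j ∈ Finset.Ico M (n + 1), ‖γ j‖) ^ 2 := by gcongr; exact norm_sum_le _ _
    have h2 := sq_sum_le_card_mul_sum_sq (s := Finset.Ico M (n + 1)) (f := fun j => ‖γ j‖)
    have h3 : ∑ j ∈ Finset.Ico M (n + 1), ‖γ j‖ ^ 2 ≤ ε / 4 := by
      have h4 := Finset.sum_range_add_sum_Ico (fun j => ‖γ j‖ ^ 2) hMn
      have h5 := h.sum_le_tsum (Finset.range (n + 1)) (fun _ _ => by positivity)
      have := (abs_lt.1 hM).2
      linarith
    have h6 : ((Finset.Ico M (n + 1)).card : ℝ) ≤ n + 1 := by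
      rw [Nat.card_Ico]; exact_mod_cast Nat.sub_le _ _
    refine h1.trans (h2.trans ?_)
    gcongr
  have hsum : ((n : ℝ) + 1) * ‖cesaroMean γ n‖ = ‖∑ j ∈ Finset.range (n + 1), γ j‖ := by
    rw [← mul_eq_sum, norm_mul]
    congr 1
    exact_mod_cast (Complex.norm_natCast (n + 1)).symm
  have hle : ((n : ℝ) + 1) * ‖cesaroMean γ n‖ ≤ C + ‖∑ j ∈ Finset.Ico M (n + 1), γ j‖ := by
    rw [hsum, ← Finset.sum_range_add_sum_Ico _ hMn]
    exact norm_add_le _ _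
  have hC : 4 * C ^ 2 < ε * (n + 1) := by
    rw [div_lt_iff₀ hε] at hN
    nlinarith
  have hsq : (((n : ℝ) + 1) * ‖cesaroMean γ n‖) ^ 2
      ≤ 2 * C ^ 2 + 2 * ‖∑ j ∈ Finset.Ico M (n + 1), γ j‖ ^ 2 := by
    have : (((n : ℝ) + 1) * ‖cesaroMean γ n‖) ^ 2
      ≤ (C + ‖∑ j ∈ Finset.Ico M (n + 1), γ j‖) ^ 2 := by gcongr
    nlinarith [sq_nonneg (C - ‖∑ j ∈ Finset.Ico M (n + 1), γ j‖)]
  rw [Real.dist_eq, sub_zero, abs_of_nonneg (by positivity)]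
  have : ((n : ℝ) + 1) * (((n : ℝ) + 1) * ‖cesaroMean γ n‖ ^ 2) < (n + 1) * ε := by nlinarith
  exact lt_of_mul_lt_mul_left this hn1.le

lemma hasSum_increments (h : Summable fun n => ‖γ n‖ ^ 2) :
    HasSum (fun j : ℕ => ((j : ℝ) + 1) * (j + 2) * ‖cesaroMean γ j - cesaroMean γ (j + 1)‖ ^ 2)
      (∑' n, ‖γ n‖ ^ 2) := by
  rw [hasSum_iff_tendsto_nat_of_nonneg fun j => by positivity]
  have h1 := (tendsto_add_atTop_iff_nat 1).2 h.hasSum.tendsto_sum_nat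
  have h2 := h1.sub (tendsto_mul_norm_sq h)
  rw [sub_zero] at h2
  refine h2.congr fun n => ?_
  rw [sum_norm_sq, add_sub_cancel_right]

/-- Weighted Cauchy–Schwarz on a telescoping sum: the reciprocal weights `1 / ((j+1)(j+2))` from `m`
onwards add up to at most `1 / (m+1)`. -/
lemma norm_sub_sq_le {D : ℝ}
    (hD : ∀ N, ∑ j ∈ Finset.range N,
      ((j : ℝ) + 1) * (j + 2) * ‖cesaroMean γ j - cesaroMean γ (j + 1)‖ ^ 2 ≤ D)
    {m n : ℕ} (hmn : m ≤ n) :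
    (m + 1) * ‖cesaroMean γ m - cesaroMean γ n‖ ^ 2 ≤ D := by
  have htel : cesaroMean γ m - cesaroMean γ n
      = ∑ j ∈ Finset.Ico m n, (cesaroMean γ j - cesaroMean γ (j + 1)) := by
    have := Finset.sum_Ico_sub (cesaroMean γ) hmn
    rw [← neg_sub (cesaroMean γ n), ← this, ← Finset.sum_neg_distrib]
    simp
  have hw : ∑ j ∈ Finset.Ico m n, (1 / (((j : ℝ) + 1) * (j + 2))) ≤ 1 / (m + 1) := by
    have h1 (j : ℕ) : 1 / (((j : ℝ) + 1) * (j + 2))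
        = -(1 / (((j + 1 : ℕ) : ℝ) + 1) - 1 / ((j : ℝ) + 1)) := by
      have : (j : ℝ) + 1 ≠ 0 := by positivity
      have : (j : ℝ) + 2 ≠ 0 := by positivity
      have : (j : ℝ) + 1 + 1 ≠ 0 := by positivity
      push_cast
      field_simp
      ring
    rw [Finset.sum_congr rfl fun j _ => h1 j, Finset.sum_neg_distrib,
      Finset.sum_Ico_sub (fun j : ℕ => 1 / ((j : ℝ) + 1)) hmn]
    have : (0 : ℝ) ≤ 1 / (n + 1) := by positivity
    linarith
  have hcs := Finset.sum_sq_le_sum_mul_sum_of_sq_le_mul (Finset.Ico m n)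
    (r := fun j => ‖cesaroMean γ j - cesaroMean γ (j + 1)‖)
    (f := fun j : ℕ => 1 / (((j : ℝ) + 1) * (j + 2)))
    (g := fun j : ℕ => ((j : ℝ) + 1) * (j + 2) * ‖cesaroMean γ j - cesaroMean γ (j + 1)‖ ^ 2)
    (fun j _ => by positivity) (fun j _ => by positivity)
    (fun j _ => by
      have : (j : ℝ) + 1 ≠ 0 := by positivity
      have : (j : ℝ) + 2 ≠ 0 := by positivity
      apply le_of_eq
      field_simp)
  have hD' : ∑ j ∈ Finset.Ico m n,
      ((j : ℝ) + 1) * (j + 2) * ‖cesaroMean γ j - cesaroMean γ (j + 1)‖ ^ 2 ≤ D := by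
    refine le_trans (Finset.sum_le_sum_of_subset_of_nonneg ?_ fun _ _ _ => by positivity) (hD n)
    intro j hj
    exact Finset.mem_range.2 (Finset.mem_Ico.1 hj).2
  have hD0 : 0 ≤ D := by simpa using hD 0
  have h1 : ‖cesaroMean γ m - cesaroMean γ n‖ ^ 2 ≤ 1 / (m + 1) * D := by
    rw [htel]
    calc _ ≤ (∑ j ∈ Finset.Ico m n, ‖cesaroMean γ j - cesaroMean γ (j + 1)‖) ^ 2 := by
          gcongr; exact norm_sum_le _ _
      _ ≤ _ := hcs
      _ ≤ _ := by
        gcongr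
  have hm : (0 : ℝ) < m + 1 := by positivity
  calc _ ≤ ((m : ℝ) + 1) * (1 / (m + 1) * D) := by gcongr
    _ = D := by field_simp

lemma sub_const (A : ℂ) (n : ℕ) :
    cesaroMean (fun n => γ n - A) n = cesaroMean γ n - A := by
  have : (n + 1 : ℂ) ≠ 0 := by exact_mod_cast n.succ_ne_zero
  rw [cesaroMean, cesaroMean, Finset.sum_sub_distrib]
  simp only [Finset.sum_const, Finset.card_range, nsmul_eq_mul]
  push_cast
  field_simp

/-- If the increments of the arithmetic means are summable with quadratic weights, then a
translate of the sequence is square summable. -/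
lemma exists_summable_sub
    (h : Summable fun j : ℕ =>
      ((j : ℝ) + 1) * (j + 2) * ‖cesaroMean γ j - cesaroMean γ (j + 1)‖ ^ 2) :
    ∃ A : ℂ, Summable fun n => ‖γ n - A‖ ^ 2 := by
  set D := ∑' j : ℕ, ((j : ℝ) + 1) * (j + 2) * ‖cesaroMean γ j - cesaroMean γ (j + 1)‖ ^ 2
  have hD (N : ℕ) := h.sum_le_tsum (Finset.range N) (fun _ _ => by positivity)
  have hD0 : 0 ≤ D := tsum_nonneg fun _ => by positivity
  have hcauchy : CauchySeq (cesaroMean γ) := by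
    rw [Metric.cauchySeq_iff']
    intro ε hε
    obtain ⟨N, hN⟩ := exists_nat_gt (D / ε ^ 2)
    refine ⟨N, fun n hn => ?_⟩
    have h1 := norm_sub_sq_le hD hn
    rw [div_lt_iff₀ (by positivity)] at hN
    rw [dist_comm, dist_eq_norm]
    refine lt_of_pow_lt_pow_left₀ 2 hε.le ?_
    nlinarith [sq_nonneg ‖cesaroMean γ N - cesaroMean γ n‖]
  obtain ⟨A, hA⟩ := cauchySeq_tendsto_of_complete hcauchy
  refine ⟨A, summable_of_sum_range_le (c := D + D) (fun _ => by positivity) fun n => ?_⟩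
  -- Letting the later index tend to infinity bounds the boundary term of the translated sequence.
  have hbound (m : ℕ) : ((m : ℝ) + 1) * ‖cesaroMean γ m - A‖ ^ 2 ≤ D := by
    have h2 : Tendsto (fun n => ((m : ℝ) + 1) * ‖cesaroMean γ m - cesaroMean γ n‖ ^ 2) atTop
        (𝓝 (((m : ℝ) + 1) * ‖cesaroMean γ m - A‖ ^ 2)) :=
      ((hA.const_sub _).norm.pow 2).const_mul _
    exact le_of_tendsto h2 ((eventually_ge_atTop m).mono fun n hn => norm_sub_sq_le hD hn)
  calc ∑ j ∈ Finset.range n, ‖γ j - A‖ ^ 2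
      ≤ ∑ j ∈ Finset.range (n + 1), ‖γ j - A‖ ^ 2 :=
        Finset.sum_le_sum_of_subset_of_nonneg (Finset.range_mono n.le_succ)
          fun _ _ _ => by positivity
    _ ≤ D + D := by
        -- Translation by `A` leaves the increments of the means unchanged.
        have h3 := sum_norm_sq (fun j => γ j - A) n
        simp only [sub_const, sub_sub_sub_cancel_right] at h3
        rw [h3]
        exact add_le_add (hD n) (hbound n)

end cesaroMean

/-! ### The local Dirichlet integral at a point of the circle. -/

lemma poissonIntegral_dirac (ζ : Metric.sphere (0 : ℂ) 1) (z : ℂ) :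
    poissonIntegral (Measure.dirac ζ) z
      = ENNReal.ofReal ((1 - ‖z‖ ^ 2) / ‖z - (ζ : ℂ)‖ ^ 2) := by
  rw [poissonIntegral, lintegral_dirac]

lemma dirichletIntegral_sum_dirac {ι : Type*} [Fintype ι] (ζ : ι → Metric.sphere (0 : ℂ) 1)
    (f : 𝔻 → ℂ) :
    dirichletIntegral (∑ i, Measure.dirac (ζ i)) f
      = ∑ i, dirichletIntegral (Measure.dirac (ζ i)) f := by
  have h (z : ℂ) : poissonIntegral (∑ i, Measure.dirac (ζ i)) z
      = ∑ i, poissonIntegral (Measure.dirac (ζ i)) z := by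
    simp only [poissonIntegral, lintegral_finsetSum_measure]
  simp only [dirichletIntegral, h, Finset.mul_sum]
  rw [lintegral_finsetSum, Finset.mul_sum]
  intro i _
  simp only [poissonIntegral_dirac]
  have := measurable_deriv (discExtend f)
  fun_prop

lemma mul_conj_sphere (ζ : Metric.sphere (0 : ℂ) 1) : (ζ : ℂ) * conj (ζ : ℂ) = 1 := by
  rw [Complex.mul_conj, Complex.normSq_eq_norm_sq, norm_eq_of_mem_sphere]
  simp

/-- As `|z - ζ| = |1 - ζ̄ z|`, the Poisson kernel can be absorbed into the holomorphic function `f'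
/ (1 - ζ̄ z)`, leaving the weight `1 - |z|²` of the Bergman norm. The Cauchy product gives its
coefficients, here rotated by the unimodular `ζ ^ (n + 1)`. -/
lemma dirichletIntegral_dirac (ζ : Metric.sphere (0 : ℂ) 1) {f : 𝔻 → ℂ} {u : ℕ → ℂ}
    (h : DiscSeries u (discExtend f)) :
    dirichletIntegral (Measure.dirac ζ) f
      = ∑' n : ℕ, ‖∑ j ∈ Finset.range (n + 1), ((j : ℂ) + 1) * (u (j + 1) * (ζ : ℂ) ^ (j + 1))‖ₑ ^ 2
          * ENNReal.ofReal (1 / ((n + 1) * (n + 2))) := by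
  have hζ := mul_conj_sphere ζ
  have hn : ‖(ζ : ℂ)‖ = 1 := norm_eq_of_mem_sphere ζ
  have hc : ‖conj (ζ : ℂ)‖ ≤ 1 := by rw [RCLike.norm_conj, hn]
  have hs := (h.deriv.mul (DiscSeries.geometric hc)).lintegral_bergman
  have hint : ∫⁻ z in Metric.ball (0 : ℂ) 1,
        ‖deriv (discExtend f) z‖ₑ ^ 2 * poissonIntegral (Measure.dirac ζ) z
      = ∫⁻ z in Metric.ball (0 : ℂ) 1,
        ‖deriv (discExtend f) z * (1 - conj (ζ : ℂ) * z)⁻¹‖ₑ ^ 2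
          * ENNReal.ofReal (1 - ‖z‖ ^ 2) := by
    refine setLIntegral_congr_fun Metric.isOpen_ball.measurableSet fun z hz => ?_
    have hz1 : ‖z‖ < 1 := by simpa using hz
    have h1 : ‖z - ζ‖ = ‖1 - conj (ζ : ℂ) * z‖ := by
      rw [show (1 : ℂ) - conj (ζ : ℂ) * z = -conj (ζ : ℂ) * (z - ζ) by linear_combination -hζ,
        norm_mul, norm_neg, RCLike.norm_conj, hn, one_mul]
    have h2 : (1 : ℂ) - conj (ζ : ℂ) * z ≠ 0 := by
      rw [← norm_pos_iff, ← h1, norm_pos_iff, sub_ne_zero]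
      rintro rfl
      exact absurd hn hz1.ne
    have h3 : 0 ≤ 1 - ‖z‖ ^ 2 := by nlinarith [norm_nonneg z]
    rw [poissonIntegral_dirac, h1, enorm_mul, mul_pow, mul_assoc]
    congr 1
    rw [div_eq_inv_mul, ENNReal.ofReal_mul (by positivity), ← ofReal_norm (_⁻¹),
      ← ENNReal.ofReal_pow (norm_nonneg _), norm_inv, inv_pow]
  have hpi : ENNReal.ofReal Real.pi ≠ 0 := by simp [Real.pi_pos]
  rw [dirichletIntegral, hint, hs, ← mul_assoc, ENNReal.inv_mul_cancel hpi ENNReal.ofReal_ne_top,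
    one_mul]
  refine tsum_congr fun n => ?_
  congr 2
  have h4 : ∑ j ∈ Finset.range (n + 1), ((j : ℂ) + 1) * (u (j + 1) * (ζ : ℂ) ^ (j + 1))
      = (ζ : ℂ) ^ (n + 1)
        * ∑ j ∈ Finset.range (n + 1), ((j : ℂ) + 1) * u (j + 1) * conj (ζ : ℂ) ^ (n - j) := by
    rw [Finset.mul_sum]
    refine Finset.sum_congr rfl fun j hj => ?_
    have : n + 1 = (j + 1) + (n - j) := by have := Finset.mem_range.1 hj; omega
    rw [this, pow_add (ζ : ℂ) (j + 1)]
    have h5 : (ζ : ℂ) ^ (n - j) * conj (ζ : ℂ) ^ (n - j) = 1 := by rw [← mul_pow, hζ, one_pow]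
    linear_combination (-((j : ℂ) + 1) * u (j + 1) * (ζ : ℂ) ^ (j + 1)) * h5
  rw [h4, enorm_mul, enorm_pow, ← ofReal_norm (ζ : ℂ), hn]
  simp

lemma dirichletIntegral_dirac_eq_cesaroMean (ζ : Metric.sphere (0 : ℂ) 1) {f : 𝔻 → ℂ}
    {u γ : ℕ → ℂ} (h : DiscSeries u (discExtend f))
    (hγ : ∀ n, u (n + 1) * (ζ : ℂ) ^ (n + 1) = γ n - γ (n + 1)) :
    dirichletIntegral (Measure.dirac ζ) f = ∑' j : ℕ, ENNReal.ofReal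
      (((j : ℝ) + 1) * (j + 2) * ‖cesaroMean γ j - cesaroMean γ (j + 1)‖ ^ 2) := by
  rw [dirichletIntegral_dirac ζ h]
  refine tsum_congr fun n => ?_
  simp only [hγ]
  rw [cesaroMean.sum_mul_sub, ← ofReal_norm, ← ENNReal.ofReal_pow (norm_nonneg _),
    ← ENNReal.ofReal_mul (by positivity)]
  congr 1
  have h1 : ‖(n + 1 : ℂ)‖ = n + 1 := by exact_mod_cast Complex.norm_natCast (n + 1)
  have h2 : ‖(n + 2 : ℂ)‖ = n + 2 := by exact_mod_cast Complex.norm_natCast (n + 2)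
  rw [norm_mul, norm_mul, h1, h2]
  have : (n : ℝ) + 1 ≠ 0 := by positivity
  have : (n : ℝ) + 2 ≠ 0 := by positivity
  field_simp

/-- Carleson's formula for the local Dirichlet integral: if `f = f(ζ) + (z - ζ) g` with `g` in the
Hardy space, then the local Dirichlet integral of `f` at `ζ` is `‖g‖²`. -/
lemma dirichletIntegral_dirac_eq_tsum (ζ : Metric.sphere (0 : ℂ) 1) {f : 𝔻 → ℂ}
    {u g : ℕ → ℂ} (h : DiscSeries u (discExtend f))
    (hg : ∀ n, u (n + 1) = g n - ζ * g (n + 1)) (hs : Summable fun n => ‖g n‖ ^ 2) :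
    dirichletIntegral (Measure.dirac ζ) f = ENNReal.ofReal (∑' n, ‖g n‖ ^ 2) := by
  have hn : ‖(ζ : ℂ)‖ = 1 := norm_eq_of_mem_sphere ζ
  have hnorm (n : ℕ) : ‖(ζ : ℂ) ^ (n + 1) * g n‖ = ‖g n‖ := by simp [hn]
  -- Multiplying the recurrence by `ζ ^ (n + 1)` turns it into a difference and does not change any
  -- modulus.
  rw [dirichletIntegral_dirac_eq_cesaroMean ζ (γ := fun n => (ζ : ℂ) ^ (n + 1) * g n) h
    (fun n => by rw [hg]; ring)]
  have := cesaroMean.hasSum_increments (γ := fun n => (ζ : ℂ) ^ (n + 1) * g n)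
    (by simpa only [hnorm] using hs)
  simp only [hnorm] at this
  rw [← ENNReal.ofReal_tsum_of_nonneg (fun n => by positivity) this.summable, this.tsum_eq]

/-- A function with finite local Dirichlet integral at `ζ` is of the form `f(ζ) + (z - ζ) g` with
`g` in the Hardy space. -/
lemma exists_of_dirichletIntegral_dirac_lt_top (ζ : Metric.sphere (0 : ℂ) 1) {f : 𝔻 → ℂ}
    {u : ℕ → ℂ} (h : DiscSeries u (discExtend f))
    (hf : dirichletIntegral (Measure.dirac ζ) f < ∞) :
    ∃ g : ℕ → ℂ, (∀ n, u (n + 1) = g n - ζ * g (n + 1)) ∧ Summable fun n => ‖g n‖ ^ 2 := by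
  have hζ := mul_conj_sphere ζ
  have hn : ‖(ζ : ℂ)‖ = 1 := norm_eq_of_mem_sphere ζ
  -- The recurrence fixes `γ` only up to an additive constant. The right constant is the `A` found
  -- below; the means of `γ` play the role of `f(0)` minus the Cesàro means of `f` at `ζ`.
  set γ : ℕ → ℂ := fun n => -∑ j ∈ Finset.range n, u (j + 1) * (ζ : ℂ) ^ (j + 1) with hγ
  have hγ1 (n : ℕ) : u (n + 1) * (ζ : ℂ) ^ (n + 1) = γ n - γ (n + 1) := by
    simp only [hγ, Finset.sum_range_succ]; ring
  rw [dirichletIntegral_dirac_eq_cesaroMean ζ h hγ1] at hf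
  have hsum : Summable fun j : ℕ =>
      ((j : ℝ) + 1) * (j + 2) * ‖cesaroMean γ j - cesaroMean γ (j + 1)‖ ^ 2 :=
    (ENNReal.summable_toReal hf.ne).congr fun j => ENNReal.toReal_ofReal (by positivity)
  obtain ⟨A, hA⟩ := cesaroMean.exists_summable_sub hsum
  refine ⟨fun n => conj (ζ : ℂ) ^ (n + 1) * (γ n - A), fun n => ?_, hA.congr fun n => ?_⟩
  · have h1 : (ζ : ℂ) ^ (n + 1) * conj (ζ : ℂ) ^ (n + 1) = 1 := by rw [← mul_pow, hζ, one_pow]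
    have h2 := hγ1 n
    simp only [pow_succ _ (n + 1)]
    linear_combination (-u (n + 1)) * h1 + conj (ζ : ℂ) ^ (n + 1) * h2
      + conj (ζ : ℂ) ^ (n + 1) * (γ (n + 1) - A) * hζ
  · simp [hn]

/-! ### The Hilbert space model for finitely many point masses. -/

section

variable {ι : Type*}

/-- Hilbert space model of the Dirichlet-type space of a finite sum of point masses on the circle:
an element consists of the Taylor coefficients of a function `f`, together with, for each point
mass `ζ i`, the Taylor coefficients of `(f - f(ζ i)) / (z - ζ i)`. -/
def dirichletModel (ζ : ι → Metric.sphere (0 : ℂ) 1) :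
    Submodule ℂ (lp (fun _ : Option ι × ℕ => ℂ) 2) where
  carrier := {x | ∀ i n, x (none, n + 1) = x (some i, n) - ζ i * x (some i, n + 1)}
  add_mem' {x y} hx hy i n := by
    simp only [lp.coeFn_add, Pi.add_apply, hx i n, hy i n]; ring
  zero_mem' i n := by simp
  smul_mem' c x hx i n := by
    simp only [lp.coeFn_smul, Pi.smul_apply, hx i n, smul_eq_mul]; ring

namespace dirichletModel

lemma memℓp_of_summable [Finite ι] {x : Option ι × ℕ → ℂ}
    (h : ∀ o, Summable fun n => ‖x (o, n)‖ ^ 2) : Memℓp x 2 := by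
  refine memℓp_gen ?_
  simp only [ENNReal.toReal_ofNat, Real.rpow_ofNat]
  exact (summable_prod_of_nonneg fun _ => by positivity).2 ⟨h, Summable.of_finite⟩

lemma summable_conj_mul_lp (x y : lp (fun _ : Option ι × ℕ => ℂ) 2) :
    Summable fun j : Option ι × ℕ => conj (x j : ℂ) * (y j : ℂ) := by
  have h := lp.summable_inner (𝕜 := ℂ) (G := fun _ : Option ι × ℕ => ℂ) x y
  refine h.congr fun j => ?_
  rw [RCLike.inner_apply']

lemma inner_lp_eq_sum [Fintype ι] (x y : lp (fun _ : Option ι × ℕ => ℂ) 2) :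
    inner ℂ x y = ∑' n : ℕ, conj (x (none, n) : ℂ) * (y (none, n) : ℂ)
      + ∑ i : ι, ∑' n : ℕ, conj (x (some i, n) : ℂ) * (y (some i, n) : ℂ) := by
  have h1 : inner ℂ x y = ∑' j : Option ι × ℕ, conj (x j : ℂ) * (y j : ℂ) := by
    rw [lp.inner_eq_tsum (𝕜 := ℂ) (G := fun _ : Option ι × ℕ => ℂ) x y]
    exact tsum_congr fun j => RCLike.inner_apply' _ _
  rw [h1, (summable_conj_mul_lp x y).tsum_prod, tsum_fintype, Fintype.sum_option]

variable {ζ : ι → Metric.sphere (0 : ℂ) 1}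

/-- The coordinates of an element of the model. -/
def coeff (x : dirichletModel ζ) (o : Option ι) (n : ℕ) : ℂ := x.1 (o, n)

lemma coeff_succ (x : dirichletModel ζ) (i : ι) (n : ℕ) :
    coeff x none (n + 1) = coeff x (some i) n - ζ i * coeff x (some i) (n + 1) :=
  x.2 i n

/-- The element of the model with given coordinates. -/
def ofCoeff [Finite ι] (ζ : ι → Metric.sphere (0 : ℂ) 1) (u : ℕ → ℂ) (g : ι → ℕ → ℂ)
    (hu : Summable fun n => ‖u n‖ ^ 2) (hg : ∀ i, Summable fun n => ‖g i n‖ ^ 2)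
    (h : ∀ i n, u (n + 1) = g i n - ζ i * g i (n + 1)) : dirichletModel ζ :=
  ⟨⟨fun j => (Option.casesOn j.1 (u j.2) fun i => g i j.2 : ℂ),
    memℓp_of_summable fun o => by cases o with
      | none => exact hu
      | some i => exact hg i⟩, fun i n => h i n⟩

lemma isClosed : IsClosed (dirichletModel ζ : Set (lp (fun _ : Option ι × ℕ => ℂ) 2)) := by
  have h : (dirichletModel ζ : Set (lp (fun _ : Option ι × ℕ => ℂ) 2))
      = ⋂ (i : ι) (n : ℕ), {x : lp (fun _ : Option ι × ℕ => ℂ) 2 |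
          (x (none, n + 1) : ℂ) = (x (some i, n) : ℂ) - (ζ i : ℂ) * (x (some i, n + 1) : ℂ)} := by
    ext x
    simp only [Set.mem_iInter]
    rfl
  rw [h]
  refine isClosed_iInter fun i => isClosed_iInter fun n => ?_
  have hc (j : Option ι × ℕ) :
      Continuous fun x : lp (fun _ : Option ι × ℕ => ℂ) 2 => (x j : ℂ) :=
    (lp.evalCLM ℂ (fun _ : Option ι × ℕ => ℂ) 2 j).continuous
  exact isClosed_eq (hc _) ((hc _).sub (continuous_const.mul (hc _)))

instance : CompleteSpace (dirichletModel ζ) :=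
  isClosed.completeSpace_coe

lemma summable_norm_sq_lp (x : lp (fun _ : Option ι × ℕ => ℂ) 2) :
    Summable fun j : Option ι × ℕ => ‖(x j : ℂ)‖ ^ 2 := by
  have h := (lp.memℓp x).summable (by simp)
  simpa only [ENNReal.toReal_ofNat, Real.rpow_ofNat] using h

lemma summable_norm_sq (x : dirichletModel ζ) (o : Option ι) :
    Summable fun n => ‖coeff x o n‖ ^ 2 :=
  (summable_norm_sq_lp x.1).prod_factor o

lemma inner_eq_sum [Fintype ι] (x y : dirichletModel ζ) :
    inner ℂ x y = ∑' n, conj (coeff x none n) * coeff y none n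
      + ∑ i, ∑' n, conj (coeff x (some i) n) * coeff y (some i) n :=
  inner_lp_eq_sum x.1 y.1

lemma summable_conj_mul (x y : dirichletModel ζ) (o : Option ι) :
    Summable fun n => conj (coeff x o n) * coeff y o n :=
  (summable_conj_mul_lp x.1 y.1).prod_factor o

lemma norm_sq_eq_sum [Fintype ι] (x : dirichletModel ζ) :
    ‖x‖ ^ 2 = ∑' n, ‖coeff x none n‖ ^ 2 + ∑ i, ∑' n, ‖coeff x (some i) n‖ ^ 2 := by
  have h := lp.norm_rpow_eq_tsum (p := 2) (by simp) x.1
  simp only [ENNReal.toReal_ofNat, Real.rpow_ofNat] at h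
  rw [Submodule.coe_norm, h, (summable_norm_sq_lp x.1).tsum_prod, tsum_fintype, Fintype.sum_option]
  rfl

/-- The vector representing the evaluation of the power series with coefficients
`x (none, n)` at the point `z`. -/
def evalVec (ι : Type*) [Finite ι] (z : 𝔻) : lp (fun _ : Option ι × ℕ => ℂ) 2 :=
  ⟨fun o => Option.casesOn o.1 (conj (z : ℂ) ^ o.2) fun _ => 0, by
    refine memℓp_of_summable fun o => ?_
    cases o with
    | none =>
      have : ‖(z : ℂ)‖ ^ 2 < 1 := z.sq_norm_lt_one
      refine (summable_geometric_of_lt_one (by positivity) this).congr fun n => ?_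
      simp only [norm_pow, RCLike.norm_conj]
      ring
    | some i => simp⟩

lemma hasSum_evalVec [Fintype ι] (z : 𝔻) (x : dirichletModel ζ) :
    HasSum (fun n => coeff x none n * (z : ℂ) ^ n) (inner ℂ (evalVec ι z) x.1) := by
  have h1 (n : ℕ) : conj (evalVec ι z (none, n) : ℂ) * (x.1 (none, n) : ℂ)
      = coeff x none n * (z : ℂ) ^ n := by
    change conj (conj (z : ℂ) ^ n) * coeff x none n = _
    rw [map_pow, Complex.conj_conj, mul_comm]
  have h2 (i : ι) (n : ℕ) : conj (evalVec ι z (some i, n) : ℂ) * (x.1 (some i, n) : ℂ) = 0 := by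
    change conj (0 : ℂ) * coeff x (some i) n = _
    simp
  rw [inner_lp_eq_sum]
  simp only [h1, h2, tsum_zero, Finset.sum_const_zero, add_zero]
  have := (summable_conj_mul_lp (evalVec ι z) x.1).prod_factor none
  simp only [h1] at this
  exact this.hasSum

/-- If `f` vanishes, the recurrence makes `‖g n‖` constant in `n`, and square summability forces it
to be zero. Thus `f` determines its quotients, so elements of the model can be regarded as
functions. -/
lemma eq_zero_of_coeff_none {x : dirichletModel ζ} (h : ∀ n, coeff x none n = 0) : x = 0 := by
  ext ⟨o, n⟩
  cases o with
  | none => exact h n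
  | some i =>
    have hnorm (n : ℕ) : ‖coeff x (some i) n‖ ^ 2 = ‖coeff x (some i) 0‖ ^ 2 := by
      induction n with
      | zero => rfl
      | succ n ih =>
        have := coeff_succ x i n
        rw [h, eq_comm, sub_eq_zero] at this
        rw [← ih, this, norm_mul, norm_eq_of_mem_sphere, one_mul]
    have hlim := (summable_norm_sq x (some i)).tendsto_atTop_zero
    simp only [hnorm] at hlim
    have h0 := tendsto_nhds_unique hlim tendsto_const_nhds
    have := hnorm n
    rw [← h0] at this
    exact norm_eq_zero.1 (pow_eq_zero_iff two_ne_zero |>.1 this)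

variable [Fintype ι]

instance : RKHS ℂ (dirichletModel ζ) 𝔻 ℂ where
  coeCLM := ContinuousLinearMap.pi fun z =>
    (innerSL ℂ (evalVec ι z)).comp (dirichletModel ζ).subtypeL
  coeCLM_injective := by
    refine (injective_iff_map_eq_zero _).2 fun x hx => eq_zero_of_coeff_none fun n => ?_
    have h1 : DiscSeries (fun n => coeff x none n) 0 := fun z hz => by
      have h2 := hasSum_evalVec (UnitDisc.mk z hz) x
      have h3 : inner ℂ (evalVec ι (UnitDisc.mk z hz)) x.1 = 0 := congrFun hx (UnitDisc.mk z hz)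
      rwa [h3] at h2
    have h4 : DiscSeries (fun _ => 0) 0 := fun z _ => by simp
    exact congrFun (h1.unique h4) n

lemma hasSum_apply (x : dirichletModel ζ) (z : 𝔻) :
    HasSum (fun n => coeff x none n * (z : ℂ) ^ n) (x z) :=
  hasSum_evalVec z x

lemma discExtend_of_norm_lt_one (f : 𝔻 → ℂ) {z : ℂ} (hz : ‖z‖ < 1) :
    discExtend f z = f (UnitDisc.mk z hz) := by
  rw [discExtend, dif_pos hz]

lemma discSeries (x : dirichletModel ζ) : DiscSeries (fun n => coeff x none n) (discExtend x) :=
  fun z hz => by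
    rw [discExtend_of_norm_lt_one _ hz]
    exact hasSum_apply x (UnitDisc.mk z hz)

lemma eq_of_discSeries (x : dirichletModel ζ) {f : 𝔻 → ℂ}
    (h : DiscSeries (fun n => coeff x none n) (discExtend f)) : (x : 𝔻 → ℂ) = f := by
  funext z
  have h1 := h z z.norm_lt_one
  rw [discExtend_of_norm_lt_one _ z.norm_lt_one, UnitDisc.mk_coe] at h1
  exact (hasSum_apply x z).unique h1

lemma dirichletIntegral_eq (x : dirichletModel ζ) :
    dirichletIntegral (∑ i, Measure.dirac (ζ i)) x
      = ENNReal.ofReal (∑ i, ∑' n, ‖coeff x (some i) n‖ ^ 2) := by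
  rw [dirichletIntegral_sum_dirac,
    ENNReal.ofReal_sum_of_nonneg fun i _ => tsum_nonneg fun n => by positivity]
  exact Finset.sum_congr rfl fun i _ =>
    dirichletIntegral_dirac_eq_tsum (ζ i) (discSeries x) (coeff_succ x i)
      (summable_norm_sq x (some i))

lemma hardyNormSq_eq (x : dirichletModel ζ) :
    hardyNormSq x = ENNReal.ofReal (∑' n, ‖coeff x none n‖ ^ 2) := by
  rw [hardyNormSq, ENNReal.ofReal_tsum_of_nonneg (fun n => by positivity) (summable_norm_sq x none)]
  refine tsum_congr fun n => ?_
  rw [discCoeff, ← (discSeries x).coeff_eq n, ENNReal.ofReal_pow (norm_nonneg _), ofReal_norm]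

theorem isDirichletTypeSpace [Nonempty ι] (ζ : ι → Metric.sphere (0 : ℂ) 1) :
    IsDirichletTypeSpace (∑ i, Measure.dirac (ζ i)) (dirichletModel ζ) where
  range_eq := by
    ext f
    constructor
    · rintro ⟨x, rfl⟩
      exact ⟨(discSeries x).differentiableOn, by
        rw [dirichletIntegral_eq]; exact ENNReal.ofReal_lt_top⟩
    · rintro ⟨hf, hfin⟩
      have hu := DiscSeries.of_differentiableOn hf
      rw [dirichletIntegral_sum_dirac, ENNReal.sum_lt_top] at hfin
      choose g hg hgs using fun i =>
        exists_of_dirichletIntegral_dirac_lt_top (ζ i) hu (hfin i (Finset.mem_univ i))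
      -- Membership in `H²` is not part of the definition of the space; it follows from `u (n+1) = g
      -- n - ζ g (n+1)` at any one point mass. For the zero measure every holomorphic function would
      -- qualify.
      have hus : Summable fun n => ‖iteratedDeriv n (discExtend f) 0 / (n.factorial : ℂ)‖ ^ 2 := by
        obtain ⟨i⟩ := ‹Nonempty ι›
        refine (summable_nat_add_iff 1).1 (Summable.of_nonneg_of_le (fun _ => by positivity)
          (fun n => ?_) (((hgs i).add ((summable_nat_add_iff 1).2 (hgs i))).mul_left 2))
        have h1 := norm_sub_le (g i n) (ζ i * g i (n + 1))
        rw [norm_mul, norm_eq_of_mem_sphere, one_mul] at h1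
        rw [hg i n]
        nlinarith [norm_nonneg (g i n - ζ i * g i (n + 1)),
          sq_nonneg (‖g i n‖ - ‖g i (n + 1)‖)]
      exact ⟨ofCoeff ζ _ g hus hgs hg, eq_of_discSeries _ hu⟩
  enorm_sq x := by
    rw [hardyNormSq_eq, dirichletIntegral_eq, ← ENNReal.ofReal_add (tsum_nonneg fun n => by
      positivity) (Finset.sum_nonneg fun i _ => tsum_nonneg fun n => by positivity),
      ← norm_sq_eq_sum, ENNReal.ofReal_pow (norm_nonneg _), ofReal_norm]

end dirichletModel

end

/-! ### Independence of the kernel from the realisation. -/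

/-- The reproducing kernel of a reproducing kernel Hilbert space of scalar functions only depends
on the functions in the space and on their norms. -/
theorem RKHS.kernel_eq_of_range_eq {X H₁ H₂ : Type*}
    [NormedAddCommGroup H₁] [InnerProductSpace ℂ H₁] [CompleteSpace H₁] [RKHS ℂ H₁ X ℂ]
    [NormedAddCommGroup H₂] [InnerProductSpace ℂ H₂] [CompleteSpace H₂] [RKHS ℂ H₂ X ℂ]
    (hrange : Set.range (fun h : H₁ => (h : X → ℂ)) = Set.range (fun h : H₂ => (h : X → ℂ)))
    (hnorm : ∀ (h₁ : H₁) (h₂ : H₂), (h₁ : X → ℂ) = h₂ → ‖h₁‖ = ‖h₂‖) (x y : X) (v : ℂ) :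
    RKHS.kernel H₁ x y v = RKHS.kernel H₂ x y v := by
  have hex (h : H₁) : ∃ h' : H₂, (h' : X → ℂ) = h := by
    have : (h : X → ℂ) ∈ Set.range (fun h : H₂ => (h : X → ℂ)) := hrange ▸ ⟨h, rfl⟩
    exact this
  choose T hT using hex
  let L : H₁ →ₗᵢ[ℂ] H₂ :=
    { toFun := T
      map_add' := fun h h' => DFunLike.coe_injective (by rw [hT, RKHS.coe_add, RKHS.coe_add, hT, hT])
      map_smul' := fun c h => DFunLike.coe_injective (by
        rw [hT, RKHS.coe_smul, RingHom.id_apply, RKHS.coe_smul, hT])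
      norm_map' := fun h => (hnorm h (T h) (hT h).symm).symm }
  have hL (h : H₁) : (L h : X → ℂ) = h := hT h
  have hsurj : Function.Surjective L := fun h' => by
    have : (h' : X → ℂ) ∈ Set.range (fun h : H₁ => (h : X → ℂ)) := hrange ▸ ⟨h', rfl⟩
    obtain ⟨h, hh⟩ := this
    exact ⟨h, DFunLike.coe_injective ((hL h).trans hh)⟩
  have hker : L (RKHS.kerFun H₁ y v) = RKHS.kerFun H₂ y v := by
    refine ext_inner_right ℂ fun h' => ?_
    obtain ⟨h, rfl⟩ := hsurj h'
    rw [L.inner_map_map, RKHS.kerFun_inner, RKHS.kerFun_inner, hL]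
  rw [← RKHS.kerFun_apply, ← RKHS.kerFun_apply, ← hker, hL]

/-- All reproducing kernel Hilbert spaces realising a Dirichlet-type space have the same kernel. -/
theorem IsDirichletTypeSpace.kernel_eq {μ : Measure (Metric.sphere (0 : ℂ) 1)} {H₁ H₂ : Type*}
    [NormedAddCommGroup H₁] [InnerProductSpace ℂ H₁] [CompleteSpace H₁] [RKHS ℂ H₁ 𝔻 ℂ]
    [NormedAddCommGroup H₂] [InnerProductSpace ℂ H₂] [CompleteSpace H₂] [RKHS ℂ H₂ 𝔻 ℂ]
    (h₁ : IsDirichletTypeSpace μ H₁) (h₂ : IsDirichletTypeSpace μ H₂) (z l : 𝔻) (v : ℂ) :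
    RKHS.kernel H₁ z l v = RKHS.kernel H₂ z l v := by
  refine RKHS.kernel_eq_of_range_eq (h₁.range_eq.trans h₂.range_eq.symm) (fun f g hfg => ?_) z l v
  have h : ‖f‖ₑ ^ 2 = ‖g‖ₑ ^ 2 := by rw [h₁.enorm_sq, h₂.enorm_sq, hfg]
  have h' := (ENNReal.pow_right_strictMono two_ne_zero).injective h
  rw [← toReal_enorm, h', toReal_enorm]

/-! ### A functional equation characterising the kernel. -/

/-- The point `1` lies inside the larger disc, and the Taylor series converges absolutely there. -/
lemma DiscSeries.summable_norm_of_differentiableOn {F : ℂ → ℂ} {R : ℝ} (hR : 1 < R)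
    (h : DifferentiableOn ℂ F (Metric.ball 0 R)) {a : ℕ → ℂ} (ha : DiscSeries a F) :
    Summable fun n => ‖a n‖ := by
  have h1 := Complex.hasSum_taylorSeries_on_ball h (z := 1) (by simpa using hR)
  refine h1.summable.norm.congr fun n => ?_
  rw [ha.coeff_eq]
  simp [div_eq_inv_mul]

lemma summable_norm_sq_of_summable_norm {a : ℕ → ℂ} (h : Summable fun n => ‖a n‖) :
    Summable fun n => ‖a n‖ ^ 2 := by
  refine Summable.of_nonneg_of_le (fun _ => by positivity) (fun n => ?_)
    (h.mul_left (∑' n, ‖a n‖))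
  rw [sq]
  gcongr
  exact h.le_tsum n fun _ _ => norm_nonneg _

/-- Summation by parts. -/
lemma sum_mul_eq_of_recurrence {ζ : ℂ} {u g c W : ℕ → ℂ}
    (hu : ∀ n, u (n + 1) = g n - ζ * g (n + 1)) (hW0 : W 0 = 0)
    (hW : ∀ n, W (n + 1) = ζ * W n + c n) (N : ℕ) :
    ∑ n ∈ Finset.range (N + 1), u n * W n
      = ∑ j ∈ Finset.range N, c j * g j - ζ * g N * W N := by
  induction N with
  | zero => simp [hW0]
  | succ N ih =>
    rw [Finset.sum_range_succ, ih, Finset.sum_range_succ, hu, hW]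
    ring

lemma norm_le_tsum_of_recurrence {ζ : ℂ} (hζ : ‖ζ‖ = 1) {c W : ℕ → ℂ} (hW0 : W 0 = 0)
    (hW : ∀ n, W (n + 1) = ζ * W n + c n) (hc : Summable fun n => ‖c n‖) (N : ℕ) :
    ‖W N‖ ≤ ∑' n, ‖c n‖ := by
  refine le_trans ?_ (hc.sum_le_tsum (Finset.range N) fun _ _ => norm_nonneg _)
  induction N with
  | zero => simp [hW0]
  | succ N ih =>
    rw [hW, Finset.sum_range_succ]
    refine (norm_add_le _ _).trans ?_
    rw [norm_mul, hζ, one_mul]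
    gcongr

namespace dirichletModel

variable {ι : Type*} [Fintype ι] {ζ : ι → Metric.sphere (0 : ℂ) 1}

/-- A criterion, in terms of coefficients, for an element of the model to represent the evaluation
at `l`. -/
lemma inner_eq_apply (k : dirichletModel ζ) (hk : ∀ i, Summable fun n => ‖coeff k (some i) n‖)
    (W : ι → ℕ → ℂ) (hW0 : ∀ i, W i 0 = 0)
    (hW : ∀ i n, W i (n + 1) = conj (ζ i : ℂ) * W i n + coeff k (some i) n) (l : 𝔻)
    (hl : ∀ n, coeff k none n + ∑ i, W i n = conj (l : ℂ) ^ n) (x : dirichletModel ζ) :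
    inner ℂ k x = x l := by
  have hlim := (tendsto_add_atTop_iff_nat 1).2 (hasSum_apply x l).tendsto_sum_nat
  have h0 := (tendsto_add_atTop_iff_nat 1).2 (summable_conj_mul k x none).hasSum.tendsto_sum_nat
  -- Summation by parts trades `N` terms in the quotient of `x` for `N + 1` terms in `x` itself. The
  -- boundary term vanishes in the limit because the quotient coefficients tend to zero while `W i`
  -- is bounded.
  have h1 (i : ι) : Tendsto (fun N => ∑ n ∈ Finset.range (N + 1), coeff x none n * conj (W i n))
      atTop (𝓝 (∑' n, conj (coeff k (some i) n) * coeff x (some i) n)) := by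
    have hsum (N : ℕ) := sum_mul_eq_of_recurrence (coeff_succ x i)
      (c := fun n => conj (coeff k (some i) n)) (W := fun n => conj (W i n)) (by simp [hW0])
      (fun n => by simp [hW]) N
    simp only [hsum]
    have h2 := (summable_conj_mul k x (some i)).hasSum.tendsto_sum_nat
    have hg : Tendsto (fun n => coeff x (some i) n) atTop (𝓝 0) := by
      have := (summable_norm_sq x (some i)).tendsto_atTop_zero.sqrt
      rw [tendsto_zero_iff_norm_tendsto_zero]
      simpa using this
    have h3 : Tendsto (fun N => ζ i * coeff x (some i) N * conj (W i N)) atTop (𝓝 0) := by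
      refine NormedField.tendsto_zero_smul_of_tendsto_zero_of_bounded
        (ε := fun N => ζ i * coeff x (some i) N) (f := fun N => conj (W i N)) ?_ ?_
      · simpa using hg.const_mul (ζ i : ℂ)
      · refine isBoundedUnder_of ⟨∑' n, ‖coeff k (some i) n‖, fun N => ?_⟩
        simp only [Function.comp_apply, RCLike.norm_conj]
        exact norm_le_tsum_of_recurrence (by simp) (hW0 i) (hW i) (hk i) N
    simpa using h2.sub h3
  have h4 := h0.add (tendsto_finsetSum Finset.univ fun i _ => h1 i)
  rw [← inner_eq_sum] at h4
  refine tendsto_nhds_unique h4 (hlim.congr fun N => ?_)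
  rw [Finset.sum_comm, ← Finset.sum_add_distrib]
  refine Finset.sum_congr rfl fun n _ => ?_
  have := congrArg conj (hl n)
  simp only [map_add, map_sum, map_pow, Complex.conj_conj] at this
  rw [← this, ← Finset.mul_sum]
  ring

/-- A criterion for a function holomorphic across the unit circle to be the kernel function of the
Dirichlet-type space at `l`. -/
theorem kernel_eq {R : ℝ} (hR : 1 < R) {k : ℂ → ℂ} (hk : DifferentiableOn ℂ k (Metric.ball 0 R))
    (l : 𝔻) (h : ∀ z : ℂ, ‖z‖ < 1 →
      k z + ∑ i, z / (1 - conj (ζ i : ℂ) * z) * ((k z - k (ζ i)) / (z - ζ i))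
        = (1 - conj (l : ℂ) * z)⁻¹) (z : 𝔻) :
    RKHS.kernel (dirichletModel ζ) z l 1 = k z := by
  have hn (i : ι) : ‖(ζ i : ℂ)‖ = 1 := norm_eq_of_mem_sphere (ζ i)
  have hsub : Metric.ball (0 : ℂ) 1 ⊆ Metric.ball 0 R := Metric.ball_subset_ball hR.le
  -- The singularity at `ζ i` is removable, so the quotient stays holomorphic across the circle and
  -- its coefficients are absolutely summable.
  set G : ι → ℂ → ℂ := fun i => dslope k (ζ i) with hG
  have hGd (i : ι) : DifferentiableOn ℂ (G i) (Metric.ball 0 R) :=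
    (Complex.differentiableOn_dslope (Metric.isOpen_ball.mem_nhds (by simp [hn, hR]))).2 hk
  have hne (i : ι) {z : ℂ} (hz : ‖z‖ < 1) : z ≠ ζ i := by
    rintro rfl; exact hz.ne (hn i)
  have hne' (i : ι) {z : ℂ} (hz : ‖z‖ < 1) : 1 - conj (ζ i : ℂ) * z ≠ 0 := fun h0 => by
    have h1 := congrArg norm (sub_eq_zero.1 h0)
    rw [norm_one, norm_mul, RCLike.norm_conj, hn, one_mul] at h1
    exact hz.ne h1.symm
  have hGz (i : ι) {z : ℂ} (hz : ‖z‖ < 1) : G i z = (k z - k (ζ i)) / (z - ζ i) := by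
    change dslope k (ζ i) z = _
    rw [dslope_of_ne _ (hne i hz), slope_def_field]
  have hks := DiscSeries.of_differentiableOn (hk.mono hsub)
  have hGs (i : ι) := DiscSeries.of_differentiableOn ((hGd i).mono hsub)
  have hVs (i : ι) : ∃ W : ℕ → ℂ, DiscSeries W fun z => z / (1 - conj (ζ i : ℂ) * z) * G i z :=
    ⟨_, DiscSeries.of_differentiableOn (DifferentiableOn.mul (DifferentiableOn.div
      differentiableOn_id (by fun_prop) fun z hz => hne' i (by simpa using hz))
      ((hGd i).mono hsub))⟩
  choose W hW using hVs
  -- For `V = z G / (1 - ζ̄ z)` one has `V = z (ζ̄ V + G)`; comparing coefficients gives the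
  -- recurrence required by `inner_eq_apply`.
  have hWrec (i : ι) : W i = fun n => Nat.casesOn n 0 fun n => conj (ζ i : ℂ) * W i n
      + iteratedDeriv n (G i) 0 / (n.factorial : ℂ) := by
    refine (hW i).unique (((((hW i).const_mul (conj (ζ i : ℂ))).add (hGs i)).shift).congr
      fun z hz => ?_)
    have := hne' i hz
    generalize hD : 1 - conj (ζ i : ℂ) * z = D at *
    field_simp
    linear_combination (-z * G i z) * hD
  have hGn (i : ι) := DiscSeries.summable_norm_of_differentiableOn hR (hGd i) (hGs i)
  have hkn := DiscSeries.summable_norm_of_differentiableOn hR hk hks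
  set K : dirichletModel ζ := ofCoeff ζ _ _ (summable_norm_sq_of_summable_norm hkn)
    (fun i => summable_norm_sq_of_summable_norm (hGn i))
    (fun i n => hks.coeff_succ_of_eq (hGs i) (α := k (ζ i)) (fun z hz => by
      rw [hGz i hz]; field_simp [sub_ne_zero.2 (hne i hz)]; ring) n) with hK
  have hKz (z : 𝔻) : K z = k z :=
    (hasSum_apply K z).unique (hks z z.norm_lt_one)
  have hcoef : (fun n => coeff K none n + ∑ i, W i n) = fun n => conj (l : ℂ) ^ n := by
    have h1 := hks.add (DiscSeries.finset_sum Finset.univ fun i _ => hW i)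
    have hl : ‖conj (l : ℂ)‖ ≤ 1 := by rw [RCLike.norm_conj]; exact l.norm_lt_one.le
    refine h1.unique ((DiscSeries.geometric hl).congr fun z hz => ?_)
    rw [← h z hz]
    congr 1
    exact Finset.sum_congr rfl fun i _ => by rw [hGz i hz]
  have hrep : RKHS.kerFun (dirichletModel ζ) l 1 = K := by
    refine ext_inner_right ℂ fun x => ?_
    rw [RKHS.kerFun_inner, inner_eq_apply K hGn W (fun i => congrFun (hWrec i) 0)
      (fun i n => congrFun (hWrec i) (n + 1)) l (congrFun hcoef) x]
    simp
  rw [← RKHS.kerFun_apply, hrep, hKz]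

end dirichletModel

/-! ### The constants in closed form, their enclosures and algebraic relations. -/

namespace KernelConstants

/-- The constant term of the factor of the quartic with roots outside the disc. -/
def b : ℝ := (3 + √7 + √(12 + 6 * √7)) / 2

/-- The linear coefficient of the factor of the quartic with roots outside the disc. -/
def a : ℝ := 3 * b / (b + 1)

/-- The diagonal of the inverse Gram matrix is `a - 1 = m * τ`. -/
def τ : ℝ := b - 2 * a + 1

/-- Minus the real part of the derivative of the outer function at `1`. -/
def p : ℝ := (b - 1) / (2 * √b)

/-- Minus the imaginary part of the derivative of the outer function at `1`. -/
def q : ℝ := τ / (2 * √b)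

/-- The off-diagonal entry of the inverse Gram matrix. -/
def s : ℂ := τ * (1 + I) * (p - q * I) ^ 2 / 2

lemma sqrt_mem_Icc {x l u : ℝ} (hl : l ^ 2 ≤ x) (hu0 : 0 ≤ u) (hu : x ≤ u ^ 2) :
    √x ∈ Set.Icc l u :=
  ⟨Real.le_sqrt_of_sq_le hl, Real.sqrt_le_iff.2 ⟨hu0, hu⟩⟩

lemma mul_mem_Icc {x y l u l' u' : ℝ} (hx : x ∈ Set.Icc l u) (hy : y ∈ Set.Icc l' u')
    (hl : 0 ≤ l) (hl' : 0 ≤ l') : x * y ∈ Set.Icc (l * l') (u * u') :=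
  ⟨mul_le_mul hx.1 hy.1 hl' (hl.trans hx.1),
    mul_le_mul hx.2 hy.2 (hl'.trans hy.1) (hl.trans (hx.1.trans hx.2))⟩

lemma sqrt_seven_mem : √7 ∈ Set.Icc (2.645751311064590590500 : ℝ) 2.645751311064590590503 :=
  sqrt_mem_Icc (by norm_num) (by norm_num) (by norm_num)

lemma sqrt_aux_mem : √(12 + 6 * √7) ∈ Set.Icc (5.27963141387611863873 : ℝ) 5.27963141387611863876 := by
  obtain ⟨h1, h2⟩ := sqrt_seven_mem
  exact sqrt_mem_Icc (by linarith) (by norm_num) (by linarith)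

lemma b_mem : b ∈ Set.Icc (5.4626913624703546145 : ℝ) 5.4626913624703546148 := by
  obtain ⟨h1, h2⟩ := sqrt_seven_mem
  obtain ⟨h3, h4⟩ := sqrt_aux_mem
  rw [b]
  constructor <;> linarith

lemma sqrt_b_mem : √b ∈ Set.Icc (2.337240116562770837 : ℝ) 2.337240116562770840 := by
  obtain ⟨h1, h2⟩ := b_mem
  exact sqrt_mem_Icc (by linarith) (by norm_num) (by linarith)

lemma a_mem : a ∈ Set.Icc (2.535797111181671182 : ℝ) 2.535797111181671185 := by
  obtain ⟨h1, h2⟩ := b_mem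
  rw [a]
  constructor
  · rw [le_div_iff₀ (by linarith)]; linarith
  · rw [div_le_iff₀ (by linarith)]; linarith

lemma τ_mem : τ ∈ Set.Icc (1.39109714010701223 : ℝ) 1.39109714010701226 := by
  obtain ⟨h1, h2⟩ := b_mem
  obtain ⟨h3, h4⟩ := a_mem
  rw [τ]
  constructor <;> linarith

lemma p_mem : p ∈ Set.Icc (0.95469253048620194 : ℝ) 0.95469253048620197 := by
  obtain ⟨h1, h2⟩ := b_mem
  obtain ⟨h3, h4⟩ := sqrt_b_mem
  rw [p]
  constructor
  · rw [le_div_iff₀ (by linarith)]; linarith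
  · rw [div_le_iff₀ (by linarith)]; linarith

lemma q_mem : q ∈ Set.Icc (0.2975939721060429 : ℝ) 0.2975939721060432 := by
  obtain ⟨h1, h2⟩ := τ_mem
  obtain ⟨h3, h4⟩ := sqrt_b_mem
  rw [q]
  constructor
  · rw [le_div_iff₀ (by linarith)]; linarith
  · rw [div_le_iff₀ (by linarith)]; linarith

lemma s_re : s.re = τ * (p * p - q * q + 2 * (p * q)) / 2 := by
  rw [s, show (τ : ℂ) * (1 + I) * (p - q * I) ^ 2 / 2
    = ((τ * (p * p - q * q + 2 * (p * q)) / 2 : ℝ) : ℂ)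
      + ((τ * (p * p - q * q - 2 * (p * q)) / 2 : ℝ) : ℂ) * I by
    push_cast
    linear_combination ((τ : ℂ) / 2 * (q ^ 2 - 2 * p * q + q ^ 2 * I)) * I_sq]
  simp

lemma s_im : s.im = τ * (p * p - q * q - 2 * (p * q)) / 2 := by
  rw [s, show (τ : ℂ) * (1 + I) * (p - q * I) ^ 2 / 2
    = ((τ * (p * p - q * q + 2 * (p * q)) / 2 : ℝ) : ℂ)
      + ((τ * (p * p - q * q - 2 * (p * q)) / 2 : ℝ) : ℂ) * I by
    push_cast
    linear_combination ((τ : ℂ) / 2 * (q ^ 2 - 2 * p * q + q ^ 2 * I)) * I_sq]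
  simp

lemma numerics :
    |a - 2.53579711118167| < 1e-13 ∧ |b - 5.46269136247034| < 1e-13 ∧
      |p - 0.954692530486206| < 1e-13 ∧ |q - 0.297593972106043| < 1e-13 ∧
      |s.re - 0.967575626606929| < 1e-13 ∧ |s.im - 0.177124344467703| < 1e-13 := by
  have ha := a_mem
  have hb := b_mem
  have hp := p_mem
  have hq := q_mem
  have hpp := mul_mem_Icc hp hp (by norm_num) (by norm_num)
  have hqq := mul_mem_Icc hq hq (by norm_num) (by norm_num)
  have hpq := mul_mem_Icc hp hq (by norm_num) (by norm_num)
  have hx : p * p - q * q + 2 * (p * q) ∈ Set.Icc (1.391097140107011 : ℝ) 1.391097140107014 := by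
    constructor <;> linarith [hpp.1, hpp.2, hqq.1, hqq.2, hpq.1, hpq.2]
  have hy : p * p - q * q - 2 * (p * q) ∈ Set.Icc (0.254654170957577 : ℝ) 0.254654170957580 := by
    constructor <;> linarith [hpp.1, hpp.2, hqq.1, hqq.2, hpq.1, hpq.2]
  have hre := mul_mem_Icc τ_mem hx (by norm_num) (by norm_num)
  have him := mul_mem_Icc τ_mem hy (by norm_num) (by norm_num)
  rw [s_re, s_im]
  refine ⟨?_, ?_, ?_, ?_, ?_, ?_⟩ <;> rw [abs_lt] <;> constructor <;> norm_num <;>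
    linarith [ha.1, ha.2, hb.1, hb.2, hp.1, hp.2, hq.1, hq.2, hre.1, hre.2, him.1, him.2]

lemma b_pos : 0 < b := by have := b_mem.1; linarith

lemma τ_pos : 0 < τ := by have := τ_mem.1; linarith

lemma mul_add_eq : a * b + a = 3 * b := by
  have := b_pos
  rw [a]; field_simp

/-- This and `mul_add_eq` are the coefficient equations of the factorization. Eliminating `a` gives
`t² - 6t + 2 = 0` for `t = b + 1/b`. Here `t = 3 + √7`, and `t² - 4 = 12 + 6√7` is the quantity
under the outer root in `b`. -/
lemma sq_add_eq : b ^ 2 + 2 * a ^ 2 + 1 = 8 * b := by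
  have hb := b_pos
  have h7 : √7 ^ 2 = 7 := Real.sq_sqrt (by norm_num)
  have hr : √(12 + 6 * √7) ^ 2 = 12 + 6 * √7 := Real.sq_sqrt (by positivity)
  have h1 : b ^ 2 + 1 = (3 + √7) * b := by
    rw [b]; linear_combination hr / 4 - h7 / 4
  have h2 : (b + 1) ^ 2 * (b ^ 2 + 2 * a ^ 2 + 1 - 8 * b) = 0 := by
    have h3 : (b + 1) * a = 3 * b := by linear_combination mul_add_eq
    have h4 : (b + 1) ^ 2 * a ^ 2 = 9 * b ^ 2 := by rw [← mul_pow, h3]; ring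
    have h5 : (b ^ 2 + 1) ^ 2 - 6 * b * (b ^ 2 + 1) + 2 * b ^ 2 = 0 := by
      rw [h1]; linear_combination b ^ 2 * h7
    linear_combination h5 + 2 * h4
  have h6 : (b + 1) ^ 2 ≠ 0 := by positivity
  have := (mul_eq_zero.1 h2).resolve_left h6
  linarith

lemma τ_sq : τ ^ 2 = 2 * a ^ 2 - 2 * b := by
  rw [τ]; linear_combination sq_add_eq - 4 * mul_add_eq

lemma sq_add_τ_sq : (b - 1) ^ 2 + τ ^ 2 = 4 * b := by
  rw [τ_sq]; linear_combination sq_add_eq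

/-- The derivatives of the outer function at `1` and `i` are unimodular, in accordance with `|O|⁻² =
1 + |z-1|⁻² + |z-i|⁻²` on the circle. -/
lemma p_sq_add_q_sq : p ^ 2 + q ^ 2 = 1 := by
  have hb := b_pos
  rw [p, q, div_pow, div_pow, ← add_div, sq_add_τ_sq, mul_pow, Real.sq_sqrt hb.le]
  field_simp
  norm_num

end KernelConstants

/-! ### Polynomial identities and the roots of the quadratic factors. -/

-- The functional equation with denominators cleared. The variable `L` stands for `λ̄`, the first
-- factor is `b` times the factor with roots inside the disc, and the last one is `conj Q(λ)`.
set_option maxRecDepth 10000 in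
lemma kernel_polynomial_identity {a b τ : ℂ} (hτ : τ = b - 2 * a + 1)
    (h : τ ^ 2 = 2 * a ^ 2 - 2 * b) (z L : ℂ) :
    (b * z ^ 2 - a * (1 + I) * z + I) * ((L - 1) * (L + I) * (z - 1) * (z - I)
        + (1 - L * z) * ((a - 1) * ((L + I) * (z - I) + (L - 1) * (z - 1))
          + τ * (-1 - I) / 2 * ((L - 1) * (z - I)) + τ * (-1 + I) / 2 * ((L + I) * (z - 1))))
      + (1 - L * z) * z *
        ((z - I) ^ 2 * (((1 - b) - τ * I) / 2 * ((a - 1) * (L + I) + τ * (-1 - I) / 2 * (L - 1)))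
        + I * (z - 1) ^ 2 * ((τ + (b - 1) * I) / 2 *
          ((a - 1) * (L - 1) + τ * (-1 + I) / 2 * (L + I))))
      = (z - 1) ^ 2 * (z - I) ^ 2 * (L ^ 2 - a * (1 - I) * L - b * I) := by
  subst hτ
  have h3 : I ^ 3 = -I := I_pow_three
  have h4 : I ^ 4 = 1 := I_pow_four
  -- After eliminating `τ`, the difference of the two sides is this cofactor times the relation
  -- between `a` and `b`.
  refine sub_eq_zero.1 (Eq.trans (b := (z ^ 4 * L ^ 2 - (1 + I) * z ^ 3 * L ^ 2 + I * z ^ 2 * L ^ 2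
    + (I - 1) / 2 * z ^ 4 * L + (1 + I) / 2 * z ^ 2 * L + (1 - I) / 2 * z ^ 3 - z ^ 2 - I * z * L
    + (1 + I) / 2 * z) * ((b - 2 * a + 1) ^ 2 - (2 * a ^ 2 - 2 * b))) ?_ (by rw [h]; ring))
  ring_nf
  simp only [I_sq, h3, h4]
  ring

/-- If the roots of `quadPoly x y` are not aligned with the origin, they have modulus `√y`. -/
lemma norm_sq_eq_of_quadPoly_eq_zero {x y : ℝ} (hxy : x ^ 2 < 2 * y) {z : ℂ}
    (hz : quadPoly x y z = 0) : ‖z‖ ^ 2 = y := by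
  have hre := congrArg Complex.re hz
  have him := congrArg Complex.im hz
  simp [quadPoly, pow_two] at hre him
  rw [← Complex.normSq_eq_norm_sq, Complex.normSq_apply]
  set u := z.re
  set v := z.im
  have h1 : (v - u) * (u + v - x) = 0 := by linear_combination -hre
  -- On the diagonal `v = u` the imaginary part is a real quadratic with negative discriminant, by
  -- `hxy`; on the line `u + v = x` it reads `u² + v² = y`.
  rcases mul_eq_zero.1 h1 with h | h
  · have : v = u := by linarith
    rw [this] at him
    nlinarith [sq_nonneg (2 * u - x)]
  · have : x = u + v := by linarith
    rw [this] at him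
    linarith

lemma conj_quadPoly (x y : ℝ) (z : ℂ) :
    conj (quadPoly x y z) = conj z ^ 2 - x * (1 - I) * conj z - y * I := by
  simp only [quadPoly, map_add, map_sub, map_mul, map_pow, Complex.conj_ofReal, map_one,
    Complex.conj_I]
  ring

lemma hasDerivAt_quadPoly (x y : ℝ) (z : ℂ) :
    HasDerivAt (quadPoly x y) (2 * z - x * (1 + I)) z := by
  have h := (((hasDerivAt_id z).pow 2).sub ((hasDerivAt_id z).const_mul (x * (1 + I)))).add_const
    (y * I)
  refine h.congr_deriv ?_
  simp

/-! ### The explicit kernel satisfies the functional equation. -/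

namespace KernelConstants

lemma quadPoly_ne_zero {z : ℂ} (hz : ‖z‖ ^ 2 < b) : quadPoly a b z ≠ 0 := fun h => by
  have hab : a ^ 2 < 2 * b := by
    obtain ⟨h1, h2⟩ := a_mem
    have := b_mem.1
    nlinarith
  exact hz.ne (norm_sq_eq_of_quadPoly_eq_zero hab h)

lemma one_lt_b : 1 < b := by have := b_mem.1; linarith

lemma mul_add_eq_ofReal : (a : ℂ) * b + a = 3 * b := by exact_mod_cast mul_add_eq

lemma sq_add_eq_ofReal : (b : ℂ) ^ 2 + 2 * a ^ 2 + 1 = 8 * b := by exact_mod_cast sq_add_eq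

lemma τ_ofReal : (τ : ℂ) = b - 2 * a + 1 := by rw [τ]; push_cast; ring

lemma τ_sq_ofReal : (τ : ℂ) ^ 2 = 2 * a ^ 2 - 2 * b := by exact_mod_cast τ_sq

lemma b_ne_zero : (b : ℂ) ≠ 0 := by exact_mod_cast b_pos.ne'

lemma τ_ne_zero : (τ : ℂ) ≠ 0 := by exact_mod_cast τ_pos.ne'

lemma quadPoly_one_ne_zero : quadPoly a b 1 ≠ 0 := quadPoly_ne_zero (by simpa using one_lt_b)

lemma quadPoly_I_ne_zero : quadPoly a b I ≠ 0 := quadPoly_ne_zero (by simpa using one_lt_b)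

/-- The first factor is `2√b O'(1)`. The identity inverts `Q(1)`, as needed both for the derivative
of the outer function and for the value of the kernel at `1`. -/
lemma mul_quadPoly_one : ((1 - b) - τ * I) * quadPoly a b 1 = 2 * b * (1 - I) := by
  rw [quadPoly, τ_ofReal]
  linear_combination (-(b - 2 * a + 1) * (b - a) : ℂ) * I_sq
    + (1 - I) * (sq_add_eq_ofReal - 2 * mul_add_eq_ofReal)

lemma mul_quadPoly_I : (τ + (b - 1) * I) * quadPoly a b I = 2 * b * (I - 1) := by
  rw [quadPoly, τ_ofReal]
  linear_combination (((b - 2 * a + 1) + (b - 1) * I) * (1 - a) + (b - 1) * (b - a) : ℂ) * I_sq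
    + (I - 1) * (sq_add_eq_ofReal - 2 * mul_add_eq_ofReal)

lemma mul_conj_eq_one : (p - q * I : ℂ) * (p + q * I) = 1 := by
  have : (p : ℂ) ^ 2 + q ^ 2 = 1 := by exact_mod_cast p_sq_add_q_sq
  linear_combination this - q ^ 2 * I_sq

lemma conj_s : conj s = τ * (1 - I) * (p + q * I) ^ 2 / 2 := by
  simp only [s, map_div₀, map_mul, map_add, map_sub, map_pow, Complex.conj_ofReal, map_one,
    Complex.conj_I, Complex.conj_ofNat]
  ring

/-- Because `q + p i = i (p - q i)`, the phase in `s` cancels. With `conj_s_div`, this leaves a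
kernel expressed in `a`, `b` and `τ` alone. -/
lemma s_div : s / (I * ((q : ℂ) + p * I) ^ 2) = τ * (-1 + I) / 2 := by
  have h0 : (p - q * I : ℂ) ≠ 0 := left_ne_zero_of_mul_eq_one mul_conj_eq_one
  have h1 : I * ((q : ℂ) + p * I) ^ 2 = -I * (p - q * I) ^ 2 := by
    rw [show (q : ℂ) + p * I = I * (p - q * I) by linear_combination (q : ℂ) * I_sq]
    linear_combination I * (p - q * I : ℂ) ^ 2 * I_sq
  rw [h1, div_eq_iff (mul_ne_zero (neg_ne_zero.2 I_ne_zero) (pow_ne_zero 2 h0)), s]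
  linear_combination (τ : ℂ) * (p - q * I) ^ 2 / 2 * I_sq

lemma conj_s_div : conj s / (-I * ((q : ℂ) - p * I) ^ 2) = τ * (-1 - I) / 2 := by
  have h0 : (p + q * I : ℂ) ≠ 0 := right_ne_zero_of_mul_eq_one mul_conj_eq_one
  have h1 : -I * ((q : ℂ) - p * I) ^ 2 = I * (p + q * I) ^ 2 := by
    rw [show (q : ℂ) - p * I = -I * (p + q * I) by linear_combination (q : ℂ) * I_sq]
    linear_combination -I * (p + q * I : ℂ) ^ 2 * I_sq
  rw [h1, div_eq_iff (mul_ne_zero I_ne_zero (pow_ne_zero 2 h0)), conj_s]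
  linear_combination (τ : ℂ) * (p + q * I) ^ 2 / 2 * I_sq

/-- The kernel function at `l`, as a rational function on the plane. -/
def kernelFn (l z : ℂ) : ℂ :=
  (b : ℂ) / (conj (quadPoly a b l) * quadPoly a b z) *
    ((conj l - 1) * (conj l + I) * (z - 1) * (z - I) / (1 - conj l * z)
      + ((a : ℂ) - 1) * ((conj l + I) * (z - I) + (conj l - 1) * (z - 1))
      + conj s * (conj l - 1) * (z - I) / (-I * ((q : ℂ) - p * I) ^ 2)
      + s * (conj l + I) * (z - 1) / (I * ((q : ℂ) + p * I) ^ 2))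

lemma kernelFn_eq (l z : ℂ) : kernelFn l z =
    (b : ℂ) / (conj (quadPoly a b l) * quadPoly a b z) *
    ((conj l - 1) * (conj l + I) * (z - 1) * (z - I) / (1 - conj l * z)
      + (((a : ℂ) - 1) * ((conj l + I) * (z - I) + (conj l - 1) * (z - 1))
      + τ * (-1 - I) / 2 * ((conj l - 1) * (z - I))
      + τ * (-1 + I) / 2 * ((conj l + I) * (z - 1)))) := by
  rw [kernelFn, ← s_div, ← conj_s_div]
  ring

lemma kernelFn_one {l : ℂ} (hl : conj (quadPoly a b l) ≠ 0) :
    kernelFn l 1 * conj (quadPoly a b l) = ((1 - b) - τ * I) / 2 *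
      ((a - 1) * (conj l + I) + τ * (-1 - I) / 2 * (conj l - 1)) := by
  have h1 := quadPoly_one_ne_zero
  rw [kernelFn_eq, sub_self, mul_zero, zero_mul, zero_div]
  have h2 (y : ℂ) : b / (conj (quadPoly a b l) * quadPoly a b 1) * y * conj (quadPoly a b l)
      = b * y / quadPoly a b 1 := by field_simp
  rw [h2, div_eq_iff h1]
  linear_combination (-1 / 2 : ℂ) * ((a - 1) * (conj l + I) + τ * (-1 - I) / 2 * (conj l - 1)) *
    mul_quadPoly_one

lemma kernelFn_I {l : ℂ} (hl : conj (quadPoly a b l) ≠ 0) :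
    kernelFn l I * conj (quadPoly a b l) = (τ + (b - 1) * I) / 2 *
      ((a - 1) * (conj l - 1) + τ * (-1 + I) / 2 * (conj l + I)) := by
  have h1 := quadPoly_I_ne_zero
  rw [kernelFn_eq, sub_self, mul_zero, zero_div]
  have h2 (y : ℂ) : b / (conj (quadPoly a b l) * quadPoly a b I) * y * conj (quadPoly a b l)
      = b * y / quadPoly a b I := by field_simp
  rw [h2, div_eq_iff h1]
  linear_combination (-1 / 2 : ℂ) * ((a - 1) * (conj l - 1) + τ * (-1 + I) / 2 * (conj l + I)) *
    mul_quadPoly_I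

/-- The second factor on the right is `z² · i · conj Q(1 / z̄)`, the reflection of `Q` in the
circle, which is how the weight becomes `|Q|² / b` on the circle. -/
lemma mul_quartic_eq (z : ℂ) :
    (b : ℂ) * ((z - 1) ^ 2 * (z - I) ^ 2 - z * (z - I) ^ 2 - I * z * (z - 1) ^ 2)
      = quadPoly a b z * (b * z ^ 2 - a * (1 + I) * z + I) := by
  rw [quadPoly]
  linear_combination (z ^ 3 * (1 + I) + z * (I - 1)) * mul_add_eq_ofReal
    - z ^ 2 * I * sq_add_eq_ofReal
    + (b * z ^ 2 - 3 * b * z - a ^ 2 * z ^ 2 + a * z + a * b * z : ℂ) * I_sq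

lemma kernelFn_identity {l z : ℂ} (hl : ‖l‖ < 1) (hz : ‖z‖ < 1) :
    kernelFn l z + (z / (1 - z) * ((kernelFn l z - kernelFn l 1) / (z - 1))
      + z / (1 + I * z) * ((kernelFn l z - kernelFn l I) / (z - I))) = (1 - conj l * z)⁻¹ := by
  have hb := one_lt_b
  have hQl : conj (quadPoly a b l) ≠ 0 := (map_ne_zero _).2 (quadPoly_ne_zero (by
    nlinarith [norm_nonneg l]))
  have hQz : quadPoly a b z ≠ 0 := quadPoly_ne_zero (by nlinarith [norm_nonneg z])
  have hz1 : z - 1 ≠ 0 := sub_ne_zero.2 fun h => by simp [h] at hz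
  have hzI : z - I ≠ 0 := sub_ne_zero.2 fun h => by simp [h] at hz
  have hD : 1 - conj l * z ≠ 0 := fun h => by
    have h1 := congrArg norm (sub_eq_zero.1 h)
    rw [norm_one, norm_mul, RCLike.norm_conj] at h1
    nlinarith [norm_nonneg l, norm_nonneg z]
  have hk : kernelFn l z * conj (quadPoly a b l) * quadPoly a b z * (1 - conj l * z)
      = b * ((conj l - 1) * (conj l + I) * (z - 1) * (z - I)
        + (1 - conj l * z) * ((a - 1) * ((conj l + I) * (z - I) + (conj l - 1) * (z - 1))
          + τ * (-1 - I) / 2 * ((conj l - 1) * (z - I))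
          + τ * (-1 + I) / 2 * ((conj l + I) * (z - 1)))) := by
    rw [kernelFn_eq]
    generalize (a - 1 : ℂ) * ((conj l + I) * (z - I) + (conj l - 1) * (z - 1))
      + τ * (-1 - I) / 2 * ((conj l - 1) * (z - I))
      + τ * (-1 + I) / 2 * ((conj l + I) * (z - 1)) = X
    field_simp
  have hk1 := kernelFn_one hQl
  have hkI := kernelFn_I hQl
  have hR := mul_quartic_eq z
  have hpoly := kernel_polynomial_identity τ_ofReal τ_sq_ofReal z (conj l)
  rw [← conj_quadPoly] at hpoly
  -- The functional equation with its poles at `1`, `i` and `1 / λ̄` cleared. Through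
  -- `mul_quartic_eq` the coefficient of `kernelFn l z` supplies the `Q(z)` that cancels its
  -- denominator.
  have h1 : (kernelFn l z * ((z - 1) ^ 2 * (z - I) ^ 2 - z * (z - I) ^ 2 - I * z * (z - 1) ^ 2)
      + z * ((z - I) ^ 2 * kernelFn l 1 + I * (z - 1) ^ 2 * kernelFn l I)) * (1 - conj l * z)
      = (z - 1) ^ 2 * (z - I) ^ 2 := by
    refine mul_left_cancel₀ (mul_ne_zero b_ne_zero hQl) ?_
    linear_combination kernelFn l z * conj (quadPoly a b l) * (1 - conj l * z) * hR
      + (b * z ^ 2 - a * (1 + I) * z + I) * hk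
      + b * (1 - conj l * z) * z * ((z - I) ^ 2 * hk1 + I * (z - 1) ^ 2 * hkI) + b * hpoly
  refine eq_inv_of_mul_eq_one_left ?_
  have h2 : z / (1 - z) = -z / (z - 1) := by rw [← neg_sub z 1, div_neg, neg_div]
  have h3 : z / (1 + I * z) = -(I * z) / (z - I) := by
    rw [show 1 + I * z = I * (z - I) by linear_combination I_sq, div_eq_div_iff
      (mul_ne_zero I_ne_zero hzI) hzI]
    linear_combination z * (z - I) * I_sq
  rw [h2, h3]
  field_simp
  linear_combination h1

end KernelConstants

/-! ### Verification of the constants and of the kernel in the model. -/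

namespace KernelConstants

lemma sqrt_d : ((√(1 / b) : ℝ) : ℂ) * √b = 1 := by
  have h : √(1 / b) * √b = 1 := by
    rw [← Real.sqrt_mul (by have := b_pos; positivity), one_div_mul_cancel b_pos.ne', Real.sqrt_one]
  exact_mod_cast h

lemma sqrt_d_ne_zero : ((√(1 / b) : ℝ) : ℂ) ≠ 0 := left_ne_zero_of_mul_eq_one sqrt_d

lemma sqrt_b_ne_zero : ((√b : ℝ) : ℂ) ≠ 0 := right_ne_zero_of_mul_eq_one sqrt_d

lemma sqrt_b_sq : ((√b : ℝ) : ℂ) ^ 2 = b := by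
  exact_mod_cast Real.sq_sqrt b_pos.le

lemma neg_p_sub_q_mul : (-(p : ℂ) - q * I) * (2 * √b) = (1 - b) - τ * I := by
  have h := sqrt_b_ne_zero
  rw [p, q]
  push_cast
  field_simp
  ring

lemma q_add_p_mul : ((q : ℂ) + p * I) * (2 * √b) = τ + (b - 1) * I := by
  have h := sqrt_b_ne_zero
  rw [p, q]
  push_cast
  field_simp

/-- The value of `(z - ζ) / O(z)` at `z = 1`. -/
lemma sqrt_d_mul_quadPoly_one :
    ((√(1 / b) : ℝ) : ℂ) * quadPoly a b 1 * (-(p : ℂ) - q * I) = 1 - I := by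
  refine mul_right_cancel₀ (mul_ne_zero two_ne_zero b_ne_zero) ?_
  rw [← sqrt_b_sq]
  linear_combination ((√(1 / b) : ℝ) : ℂ) * quadPoly a b 1 * √b * neg_p_sub_q_mul
    + ((1 - b) - τ * I) * quadPoly a b 1 * sqrt_d + mul_quadPoly_one - 2 * (1 - I) * sqrt_b_sq

lemma sqrt_d_mul_quadPoly_I :
    ((√(1 / b) : ℝ) : ℂ) * quadPoly a b I * ((q : ℂ) + p * I) = I - 1 := by
  refine mul_right_cancel₀ (mul_ne_zero two_ne_zero b_ne_zero) ?_
  rw [← sqrt_b_sq]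
  linear_combination ((√(1 / b) : ℝ) : ℂ) * quadPoly a b I * √b * q_add_p_mul
    + (τ + (b - 1) * I) * quadPoly a b I * sqrt_d + mul_quadPoly_I - 2 * (I - 1) * sqrt_b_sq

/-- At a zero of the numerator the quotient rule keeps only the derivative of the numerator. -/
lemma hasDerivAt_outerFn {z D : ℂ} (hz : (z - 1) * (z - I) = 0) (hQ : quadPoly a b z ≠ 0)
    (hD : ((√(1 / b) : ℝ) : ℂ) * quadPoly a b z * D = 2 * z - 1 - I) :
    HasDerivAt (outerFn a b (1 / b)) D z := by
  have h1 : HasDerivAt (fun z : ℂ => (z - 1) * (z - I)) (2 * z - 1 - I) z :=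
    (((hasDerivAt_id z).sub_const 1).mul ((hasDerivAt_id z).sub_const I)).congr_deriv (by
      simp only [id]; ring)
  have h2 : HasDerivAt (fun z : ℂ => ((√(1 / b) : ℝ) : ℂ) * quadPoly a b z)
      (((√(1 / b) : ℝ) : ℂ) * (2 * z - a * (1 + I))) z := (hasDerivAt_quadPoly a b z).const_mul _
  refine (h1.div h2 (mul_ne_zero sqrt_d_ne_zero hQ)).congr_deriv ?_
  have h3 := sqrt_d_ne_zero
  rw [hz, ← hD]
  field_simp
  ring

/-- The choices `c = a / b` and `d = 1 / b` are forced by reflecting `Q` in the circle. The matrix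
inversion amounts to `m = (a - 1) / τ`, `s = -τ w` and determinant `1 / τ`. -/
theorem isKernelConstants :
    IsKernelConstants a b (a / b) (1 / b) p q ((a - 1) / τ) s where
  factorization z := by
    have hb := b_ne_zero
    have h : (b : ℂ) * (z ^ 4 - (3 + 3 * I) * z ^ 3 + 8 * I * z ^ 2 + (3 - 3 * I) * z - 1)
        = quadPoly a b z * (b * z ^ 2 - a * (1 + I) * z + I) := by
      rw [← mul_quartic_eq]
      linear_combination (-b * (z ^ 2 - 3 * z + 1)) * I_sq
    refine mul_left_cancel₀ hb (h.trans ?_)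
    rw [quadPoly, quadPoly]
    push_cast
    field_simp
  root_outside z hz := by
    by_contra hlt
    refine quadPoly_ne_zero ?_ hz
    have := one_lt_b
    nlinarith [norm_nonneg z]
  root_inside z hz := by
    have hb := one_lt_b
    have hab : (a / b) ^ 2 < 2 * (1 / b) := by
      obtain ⟨h1, h2⟩ := a_mem
      have h3 := b_mem.1
      rw [div_pow, mul_one_div, div_lt_div_iff₀ (by positivity) (by positivity)]
      have h4 : a ^ 2 < 2 * b := by nlinarith
      nlinarith
    have h := norm_sq_eq_of_quadPoly_eq_zero hab hz
    have h1 : 1 / b < 1 := (div_lt_one (by linarith)).2 hb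
    nlinarith [norm_nonneg z]
  d_pos := by have := b_pos; positivity
  deriv_one := hasDerivAt_outerFn (by simp) quadPoly_one_ne_zero (by
    rw [sqrt_d_mul_quadPoly_one]; ring)
  deriv_I := hasDerivAt_outerFn (by simp) quadPoly_I_ne_zero (by
    rw [sqrt_d_mul_quadPoly_I]; ring)
  deriv_quot := by
    have hE := sqrt_d_mul_quadPoly_one
    have h1 : HasDerivAt (fun z : ℂ => z - I) 1 1 := (hasDerivAt_id 1).sub_const I
    have h2 : HasDerivAt (fun z : ℂ => ((√(1 / b) : ℝ) : ℂ) * quadPoly a b z * (-(p : ℂ) - q * I))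
        (((√(1 / b) : ℝ) : ℂ) * (2 * 1 - a * (1 + I)) * (-(p : ℂ) - q * I)) 1 :=
      ((hasDerivAt_quadPoly a b 1).const_mul _).mul_const _
    have hI : (1 : ℂ) - I ≠ 0 := fun h => by simpa using congrArg Complex.re h
    refine (h1.div h2 (by rw [hE]; exact hI)).congr_deriv ?_
    rw [hE, div_eq_iff (pow_ne_zero 2 hI)]
    refine mul_left_cancel₀ (mul_ne_zero τ_ne_zero quadPoly_one_ne_zero) ?_
    have hm : (((a - 1) / τ : ℝ) : ℂ) * τ = a - 1 := by
      push_cast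
      exact div_mul_cancel₀ _ τ_ne_zero
    have hrel : τ * (quadPoly a b 1 - (1 - I) * (2 - a * (1 + I)))
        = (a - 1) * (1 - I) * quadPoly a b 1 := by
      rw [quadPoly, τ_ofReal]
      linear_combination I * (sq_add_eq_ofReal - 4 * mul_add_eq_ofReal) + (a ^ 2 - b : ℂ) * I_sq
    linear_combination (-τ * (1 - I) * (2 - a * (1 + I))) * hE + (1 - I) * hrel
      - quadPoly a b 1 * (1 - I) ^ 2 * hm
  inverse w hw := by
    have hpq := mul_conj_eq_one
    -- As `p + q i` is unimodular, its inverse is `p - q i`, which removes the denominator of `w`.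
    have hw' : w = (p - q * I) ^ 2 * (-1 - I) / 2 := by
      have h : (-(p : ℂ) - q * I) * conj ((q : ℂ) + p * I) * (1 + I)
          * ((p - q * I) ^ 2 * (-1 - I) / 2) = 1 := by
        rw [map_add, map_mul, Complex.conj_ofReal, Complex.conj_ofReal, Complex.conj_I,
          show (q : ℂ) + p * -I = -I * (p + q * I) by linear_combination (q : ℂ) * I_sq]
        linear_combination (-I * (1 + I) ^ 2 / 2 * ((p - q * I) * (p + q * I) + 1)) * hpq
          + (-1 - I / 2) * I_sq
      rw [hw]
      exact (eq_one_div_of_mul_eq_one_right h).symm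
    have hcw : conj w = (p + q * I) ^ 2 * (-1 + I) / 2 := by
      simp only [hw', map_div₀, map_mul, map_sub, map_pow, map_neg, Complex.conj_ofReal, map_one,
        Complex.conj_I, Complex.conj_ofNat]
      ring
    have hτ := τ_ne_zero
    -- Since `|w|² = 1/2`, this is the determinant condition `m² - |w|² = 1 / τ`.
    have hm : (((a - 1) / τ : ℝ) : ℂ) * (a - 1) = 1 + τ / 2 := by
      have h : (a - 1 : ℂ) * (a - 1) = (1 + τ / 2) * τ := by
        linear_combination -τ_ofReal - τ_sq_ofReal / 2
      push_cast
      rw [div_mul_eq_mul_div, div_eq_iff hτ, h]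
    have hms (x : ℂ) : (((a - 1) / τ : ℝ) : ℂ) * (τ * x) = (a - 1) * x := by
      push_cast
      field_simp
    have hs : s = τ * ((1 + I) * (p - q * I) ^ 2 / 2) := by rw [s]; ring
    have hcs : conj s = τ * ((1 - I) * (p + q * I) ^ 2 / 2) := by rw [conj_s]; ring
    have e1 : w * conj s = -τ / 2 := by
      rw [hw', conj_s]
      linear_combination (τ * (-1 - I) * (1 - I) / 4 * ((p - q * I) * (p + q * I) + 1)) * hpq
        + τ / 4 * I_sq
    have e2 : conj w * s = -τ / 2 := by
      rw [hcw, s]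
      linear_combination (τ * (-1 + I) * (1 + I) / 4 * ((p - q * I) * (p + q * I) + 1)) * hpq
        + τ / 4 * I_sq
    have h12 : (((a - 1) / τ : ℝ) : ℂ) * s + w * (a - 1) = 0 := by
      rw [hs, hms, hw']; ring
    have h21 : conj w * (a - 1) + (((a - 1) / τ : ℝ) : ℂ) * conj s = 0 := by
      rw [hcs, hms, hcw]; ring
    rw [Matrix.mul_fin_two, Matrix.one_fin_two, h12, h21, e1, e2, hm,
      show (1 : ℂ) + τ / 2 + -τ / 2 = 1 by ring, show -(τ : ℂ) / 2 + (1 + τ / 2) = 1 by ring]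

/-- The two point masses of `δ₁ + δ_i`. -/
def points : Fin 2 → Metric.sphere (0 : ℂ) 1 := ![circleOne, circleI]

lemma sum_dirac_points : ∑ i, Measure.dirac (points i) = diracOneAddDiracI := by
  rw [Fin.sum_univ_two]
  rfl

lemma isDirichletTypeSpace_model :
    IsDirichletTypeSpace diracOneAddDiracI (dirichletModel points) :=
  sum_dirac_points ▸ dirichletModel.isDirichletTypeSpace points

/-- The kernel function has its possible poles at the zeros of `Q`, of modulus `√b`, and at `1 /
λ̄`. The bound `2 / (1 + |λ|)` lies strictly between `1` and `1 / |λ|`, and also makes sense for `λ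
= 0`. -/
lemma exists_radius {l : ℂ} (hl : ‖l‖ < 1) :
    ∃ R : ℝ, 1 < R ∧ ∀ z : ℂ, ‖z‖ < R → ‖z‖ ^ 2 < b ∧ ‖l‖ * ‖z‖ < 1 := by
  have hb := one_lt_b
  have hl0 := norm_nonneg l
  refine ⟨min √b (2 / (1 + ‖l‖)), lt_min ?_ ?_, fun z hz => ?_⟩
  · rw [Real.lt_sqrt zero_le_one]; linarith
  · rw [lt_div_iff₀ (by linarith)]; linarith
  · obtain ⟨h1, h2⟩ := lt_min_iff.1 hz
    rw [Real.lt_sqrt (norm_nonneg z)] at h1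
    rw [lt_div_iff₀ (by linarith)] at h2
    exact ⟨h1, by nlinarith [norm_nonneg z]⟩

lemma kernel_model (z l : 𝔻) :
    RKHS.kernel (dirichletModel points) z l 1 = kernelFn l z := by
  obtain ⟨R, hR, hRz⟩ := exists_radius l.norm_lt_one
  have hQl : conj (quadPoly a b l) ≠ 0 := (map_ne_zero _).2 (quadPoly_ne_zero (by
    nlinarith [one_lt_b, norm_nonneg (l : ℂ), l.norm_lt_one]))
  refine dirichletModel.kernel_eq hR (k := kernelFn l) ?_ l (fun z hz => ?_) z
  · rw [funext (kernelFn_eq l)]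
    have hQ : DifferentiableOn ℂ (fun z => conj (quadPoly a b l) * quadPoly a b z)
        (Metric.ball 0 R) := fun z _ =>
      ((hasDerivAt_quadPoly a b z).differentiableAt.const_mul _).differentiableWithinAt
    refine DifferentiableOn.mul ((differentiableOn_const _).div hQ fun z hz =>
      mul_ne_zero hQl (quadPoly_ne_zero (hRz z (by simpa using hz)).1)) ?_
    refine DifferentiableOn.add (DifferentiableOn.div (by fun_prop) (by fun_prop) fun z hz h => ?_)
      (by fun_prop)
    have h1 := congrArg norm (sub_eq_zero.1 h)
    rw [norm_one, norm_mul, RCLike.norm_conj] at h1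
    exact (hRz z (by simpa using hz)).2.ne h1.symm
  · rw [Fin.sum_univ_two]
    have h := kernelFn_identity l.norm_lt_one hz
    have h0 : ((points 0 : Metric.sphere (0 : ℂ) 1) : ℂ) = 1 := rfl
    have h1 : ((points 1 : Metric.sphere (0 : ℂ) 1) : ℂ) = I := rfl
    rw [h0, h1, map_one, one_mul, Complex.conj_I, neg_mul, sub_neg_eq_add]
    exact h

end KernelConstants

end

/-- The reproducing kernel of `D(δ₁ + δ_i)`. -/
theorem theorem2p1 :
    ∃ (a b c d p q m : ℝ) (s : ℂ),
      IsKernelConstants a b c d p q m s ∧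
      (|a - 2.53579711118167| < 1e-13 ∧ |b - 5.46269136247034| < 1e-13 ∧
        |p - 0.954692530486206| < 1e-13 ∧ |q - 0.297593972106043| < 1e-13 ∧
        |s.re - 0.967575626606929| < 1e-13 ∧ |s.im - 0.177124344467703| < 1e-13) ∧
      (∃ (H : Type) (_ : NormedAddCommGroup H) (_ : InnerProductSpace ℂ H) (_ : CompleteSpace H)
        (_ : RKHS ℂ H 𝔻 ℂ), IsDirichletTypeSpace diracOneAddDiracI H) ∧
      ∀ (H : Type*) [NormedAddCommGroup H] [InnerProductSpace ℂ H] [CompleteSpace H]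
        [RKHS ℂ H 𝔻 ℂ], IsDirichletTypeSpace diracOneAddDiracI H →
        ∀ z l : 𝔻,
          RKHS.kernel H z l 1 =
            (b : ℂ) / (conj (quadPoly a b (l : ℂ)) * quadPoly a b (z : ℂ)) *
              ((conj (l : ℂ) - 1) * (conj (l : ℂ) + I) * ((z : ℂ) - 1) * ((z : ℂ) - I)
                  / (1 - conj (l : ℂ) * (z : ℂ))
                + ((a : ℂ) - 1) * ((conj (l : ℂ) + I) * ((z : ℂ) - I)
                    + (conj (l : ℂ) - 1) * ((z : ℂ) - 1))
                + conj s * (conj (l : ℂ) - 1) * ((z : ℂ) - I)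
                    / (-I * ((q : ℂ) - p * I) ^ 2)
                + s * (conj (l : ℂ) + I) * ((z : ℂ) - 1)
                    / (I * ((q : ℂ) + p * I) ^ 2)) := by
  refine ⟨KernelConstants.a, KernelConstants.b, _, _, KernelConstants.p, KernelConstants.q, _,
    KernelConstants.s, KernelConstants.isKernelConstants, KernelConstants.numerics,
    ⟨dirichletModel KernelConstants.points, inferInstance, inferInstance, inferInstance,
      inferInstance, KernelConstants.isDirichletTypeSpace_model⟩, ?_⟩
  intro H _ _ _ _ hH z l
  rw [hH.kernel_eq KernelConstants.isDirichletTypeSpace_model, KernelConstants.kernel_model]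
  rfl
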